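/- Let $\mathbf k$ be a field of characteristic $0$ and $\lambda\in\mathbf k$. A (left) Leibniz algebra is a $\mathbf k$-vector space $\mathfrak g$ with a bilinear bracket satisfying $[x,[y,z]_{\mathfrak g}]_{\mathfrak g}=[[x,y]_{\mathfrak g},z]_{\mathfrak g}+[y,[x,z]_{\mathfrak g}]_{\mathfrak g}$. Let $(\mathfrak g,\mu_{\mathfrak g}=[\,,]_{\mathfrak g})$ and $(\mathfrak h,\mu_{\mathfrak h}=[\,,]_{\mathfrak h})$ be Leibniz algebras, and let $\mathfrak h$ be a Leibniz $\mathfrak g$-representation: there are bilinear maps $\rho^L:\mathfrak g\otimes\mathfrak h\to\mathfrak h$ and $\rho^R:\mathfrak h\otimes\mathfrak g\to\mathfrak h$ such that, for all $x,y\in\mathfrak g$ and $u,v\in\mathfrak h$, $$\rho^L(x,\rho^L(y,v))=\rho^L([x,y]_{\mathfrak g},v)+\rho^L(y,\rho^L(x,v)),$$ $$\rho^L(x,\rho^R(v,y))=\rho^R(\rho^L(x,v),y)+\rho^R(v,[x,y]_{\mathfrak g}),$$ $$\rho^R(v,[x,y]_{\mathfrak g})=\rho^R(\rho^R(v,x),y)+\rho^L(x,\rho^R(v,y)),$$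 $$[u,\rho^R(v,x)]_{\mathfrak h}=\rho^R([u,v]_{\mathfrak h},x)+[v,\rho^R(u,x)]_{\mathfrak h},$$ $$[u,\rho^L(x,v)]_{\mathfrak h}=[\rho^R(u,x),v]_{\mathfrak h}+\rho^L(x,[u,v]_{\mathfrak h}),$$ $$\rho^L(x,[u,v]_{\mathfrak h})=[\rho^L(x,u),v]_{\mathfrak h}+[u,\rho^L(x,v)]_{\mathfrak h}.$$ For a vector space $V$, the Balavoine bracket on $L=\bigoplus_{n\ge0}\mathrm{Hom}(V^{\otimes n+1},V)$ is the bilinear bracket given, for $f\in\mathrm{Hom}(V^{\otimes m+1},V)$ and $f'\in\mathrm{Hom}(V^{\otimes n+1},V)$, by $$[f,f']_B=\sum_{i=1}^{m+1}(-1)^{(i-1)n}f\circ_i f'-(-1)^{mn}\sum_{i=1}^{n+1}(-1)^{(i-1)m}f'\circ_i f,$$ where $$(f\circ_i f')(x_1,\dots,x_{m+n+1})=\sum_{\sigma\in Sh(i-1,n)}(-1)^\sigma f\big(x_{\sigma(1)},\dots,x_{\sigma(i-1)},f'(x_{\sigma(i)},\dots,x_{\sigma(i+n-1)},x_{i+n}),x_{i+n+1},\dots,x_{m+n+1}\big)$$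 and $Sh(p,q)$ is the set of $(p,q)$-shuffles. Take $V=\mathfrak g\oplus\mathfrak h$, and let $\theta=\mu_{\mathfrak g}+\rho^L+\rho^R$ and $\theta'=-\lambda\mu_{\mathfrak h}$ be the elements of $\mathrm{Hom}(V^{\otimes2},V)$ given by $$\theta((x,u),(y,v))=([x,y]_{\mathfrak g},\rho^L(x,v)+\rho^R(u,y)),\qquad \theta'((x,u),(y,v))=(0,-\lambda[u,v]_{\mathfrak h}).$$ Regard $\bigoplus_{n\ge1}\mathrm{Hom}(\mathfrak h^{\otimes n},\mathfrak g)$ as a subspace of $L$, by identifying $P\in\mathrm{Hom}(\mathfrak h^{\otimes n},\mathfrak g)$ with the map $((x_1,u_1),\dots,(x_n,u_n))\mapsto(P(u_1,\dots,u_n),0)$, and grade it by giving $\mathrm{Hom}(\mathfrak h^{\otimes n},\mathfrak g)$ degree $n$. **Theorem.** This subspace is closed under the operations $$[\![P,Q]\!]=(-1)^m[[\theta,P]_B,Q]_B\quad(P\in\mathrm{Hom}(\mathfrak h^{\otimes m},\mathfrak g)),\qquad dP=[\theta',P]_B,$$ and $\big(\bigoplus_{n\ge1}\mathrm{Hom}(\mathfrak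 h^{\otimes n},\mathfrak g),[\![\,,]\!],d\big)$ is a differential graded Lie algebra: for homogeneous $P,Q,R$, with $P,Q$ of degrees $m,n$, the bracket has degree $0$ and $d$ has degree $1$, $[\![P,Q]\!]=-(-1)^{mn}[\![Q,P]\!]$, $[\![P,[\![Q,R]\!]]\!]=[\![[\![P,Q]\!],R]\!]+(-1)^{mn}[\![Q,[\![P,R]\!]]\!]$, $d^2=0$, and $d[\![P,Q]\!]=[\![dP,Q]\!]+(-1)^m[\![P,dQ]\!]$. Moreover, a linear map $T:\mathfrak h\to\mathfrak g$ is a $\lambda$-weighted relative Rota–Baxter operator, that is, $$[Tu,Tv]_{\mathfrak g}=T\big(\rho^L(Tu,v)+\rho^R(u,Tv)+\lambda[u,v]_{\mathfrak h}\big)\quad\text{for all }u,v\in\mathfrak h,$$ if and only if $T$ is a Maurer–Cartan element of this differential graded Lie algebra, that is, $dT+\tfrac12[\![T,T]\!]=0$ (where $T$ has degree $1$). -/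

import Mathlib

open scoped DirectSum

namespace LeibnizRB

/-! ### Differential graded Lie algebras and Maurer-Cartan elements -/

section DGLie

variable {k E : Type*} [Field k] [AddCommGroup E] [Module k E]

/-- The `ℤ`-graded vector space `E = ⨁ i, 𝒜 i`, with the bilinear map `br` and the linear map `d`,
is a differential graded Lie algebra (cohomological convention: `d` has degree `1`). -/
structure IsDGLieAlgebra (𝒜 : ℤ → Submodule k E) (br : E →ₗ[k] E →ₗ[k] E) (d : E →ₗ[k] E) :
    Prop where
  isInternal : DirectSum.IsInternal 𝒜
  br_mem : ∀ i j : ℤ, ∀ x ∈ 𝒜 i, ∀ y ∈ 𝒜 j, br x y ∈ 𝒜 (i + j)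
  br_skew : ∀ i j : ℤ, ∀ x ∈ 𝒜 i, ∀ y ∈ 𝒜 j, br x y = -((i * j).negOnePow • br y x)
  br_jacobi : ∀ i j l : ℤ, ∀ x ∈ 𝒜 i, ∀ y ∈ 𝒜 j, ∀ z ∈ 𝒜 l,
    br x (br y z) = br (br x y) z + (i * j).negOnePow • br y (br x z)
  d_mem : ∀ i : ℤ, ∀ x ∈ 𝒜 i, d x ∈ 𝒜 (i + 1)
  d_comp_d : ∀ x : E, d (d x) = 0
  d_br : ∀ i j : ℤ, ∀ x ∈ 𝒜 i, ∀ y ∈ 𝒜 j,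
    d (br x y) = br (d x) y + i.negOnePow • br x (d y)

/-- Maurer-Cartan elements: elements `x` of degree `1` with `d x + 1/2 [x, x] = 0`. -/
def IsMaurerCartan (𝒜 : ℤ → Submodule k E) (br : E →ₗ[k] E →ₗ[k] E) (d : E →ₗ[k] E)
    (x : E) : Prop :=
  x ∈ 𝒜 1 ∧ d x + (2⁻¹ : k) • br x x = 0

end DGLie

/-! ### Leibniz algebras, representations and relative Rota-Baxter operators -/

section Leibniz

variable {k g h : Type*} [Field k] [AddCommGroup g] [Module k g] [AddCommGroup h] [Module k h]

/-- The bilinear bracket `μ` makes `g` into a (left) Leibniz algebra. -/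
def IsLeibniz (μ : g →ₗ[k] g →ₗ[k] g) : Prop :=
  ∀ x y z : g, μ x (μ y z) = μ (μ x y) z + μ y (μ x z)

/-- `(h, ρL, ρR)` is a representation of the Leibniz algebra `(g, μg)`. -/
structure IsRepresentation (μg : g →ₗ[k] g →ₗ[k] g)
    (ρL : g →ₗ[k] h →ₗ[k] h) (ρR : h →ₗ[k] g →ₗ[k] h) : Prop where
  left_left : ∀ (x y : g) (v : h), ρL x (ρL y v) = ρL (μg x y) v + ρL y (ρL x v)
  left_right : ∀ (x y : g) (v : h), ρL x (ρR v y) = ρR (ρL x v) y + ρR v (μg x y)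
  right_right : ∀ (x y : g) (v : h), ρR v (μg x y) = ρR (ρR v x) y + ρL x (ρR v y)

/-- The Leibniz algebra `(h, μh)` is a Leibniz `g`-representation. -/
structure IsLeibnizRepresentation (μg : g →ₗ[k] g →ₗ[k] g) (μh : h →ₗ[k] h →ₗ[k] h)
    (ρL : g →ₗ[k] h →ₗ[k] h) (ρR : h →ₗ[k] g →ₗ[k] h) : Prop
    extends IsRepresentation μg ρL ρR where
  br_right : ∀ (u v : h) (x : g), μh u (ρR v x) = ρR (μh u v) x + μh v (ρR u x)
  br_left : ∀ (u v : h) (x : g), μh u (ρL x v) = μh (ρR u x) v + ρL x (μh u v)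
  left_br : ∀ (u v : h) (x : g), ρL x (μh u v) = μh (ρL x u) v + μh u (ρL x v)

/-- `T : h → g` is a `c`-weighted relative Rota-Baxter operator. -/
def IsRelativeRotaBaxter (μg : g →ₗ[k] g →ₗ[k] g) (μh : h →ₗ[k] h →ₗ[k] h)
    (ρL : g →ₗ[k] h →ₗ[k] h) (ρR : h →ₗ[k] g →ₗ[k] h) (c : k) (T : h →ₗ[k] g) : Prop :=
  ∀ u v : h, μg (T u) (T v) = T (ρL (T u) v + ρR u (T v) + c • μh u v)

end Leibniz

/-! ### The Balavoine bracket -/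

section Balavoine

variable (k V : Type*) [Field k] [AddCommGroup V] [Module k V]

/-- `Hom(V^{⊗ (n+1)}, W)`, as the space of multilinear maps in `n + 1` variables. -/
abbrev Cochain (W : Type*) [AddCommGroup W] [Module k W] (n : ℕ) : Type _ :=
  MultilinearMap k (fun _ : Fin (n + 1) => V) W

/-- `⨁_{n ≥ 0} Hom(V^{⊗ (n+1)}, W)`. -/
abbrev CochainSpace (W : Type*) [AddCommGroup W] [Module k W] : Type _ :=
  ⨁ n : ℕ, Cochain k V W n

variable {k V}

/-- In `m + n + 1` variables, the position of the `j`-th argument of `f` (`j ≠ i`) when a map of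
`n + 1` variables is inserted in its `i`-th argument (everything is numbered from `0`). -/
def outerPos {m : ℕ} (n : ℕ) (i j : Fin (m + 1)) : Fin (m + n + 1) :=
  if j < i then ⟨j, by omega⟩ else ⟨j + n, by omega⟩

/-- The position of the `l`-th argument of the inserted map. -/
def innerPos {m n : ℕ} (i : Fin (m + 1)) (l : Fin (n + 1)) : Fin (m + n + 1) :=
  ⟨i + l, by omega⟩

theorem outerPos_injective {m : ℕ} (n : ℕ) (i : Fin (m + 1)) :
    Function.Injective (outerPos n i) := by
  intro a b hab
  unfold outerPos at hab
  split_ifs at hab <;> simp only [Fin.mk.injEq, Fin.lt_def] at * <;> ext <;> omega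

theorem innerPos_injective {m n : ℕ} (i : Fin (m + 1)) :
    Function.Injective (innerPos (n := n) i) := by
  intro a b hab
  simp only [innerPos, Fin.mk.injEq] at hab
  ext; omega

theorem position_cases {m n : ℕ} (i : Fin (m + 1)) (t : Fin (m + n + 1)) :
    (∃ l : Fin (n + 1), innerPos i l = t ∧ ∀ j, j ≠ i → outerPos n i j ≠ t) ∨
    (∃ j : Fin (m + 1), j ≠ i ∧ outerPos n i j = t ∧ ∀ l : Fin (n + 1), innerPos i l ≠ t) := by
  rcases lt_or_ge (t : ℕ) i with h1 | h1
  · right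
    refine ⟨⟨t, by omega⟩, ?_, ?_, ?_⟩
    · intro h; rw [← h] at h1; simp at h1
    · unfold outerPos; rw [if_pos (by simpa [Fin.lt_def] using h1)]
    · intro l h; rw [← h] at h1; simp [innerPos] at h1
  rcases le_or_gt (t : ℕ) (i + n) with h2 | h2
  · left
    refine ⟨⟨t - i, by omega⟩, ?_, ?_⟩
    · ext; simp [innerPos]; omega
    · intro j hj h
      have hj' : (j : ℕ) ≠ i := fun e => hj (Fin.ext e)
      rw [← h] at h1 h2
      unfold outerPos at h1 h2
      split_ifs at h1 h2 with h3 <;> simp only [Fin.lt_def] at h1 h2 h3 <;> omega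
  · right
    refine ⟨⟨t - n, by omega⟩, ?_, ?_, ?_⟩
    · intro h; rw [← h] at h2; simp at h2; omega
    · unfold outerPos
      rw [if_neg (by simp [Fin.lt_def]; omega)]
      ext; simp; omega
    · intro l h; rw [← h] at h2; simp [innerPos] at h2; omega

/-- The arguments fed to `f` when `f'` is inserted in its `i`-th argument. -/
def insertArgs {m n : ℕ} (i : Fin (m + 1)) (f' : Cochain k V V n) (x : Fin (m + n + 1) → V) :
    Fin (m + 1) → V :=
  Function.update (fun j => x (outerPos n i j)) i (f' fun l => x (innerPos i l))

theorem insertArgs_update {m n : ℕ} (i : Fin (m + 1)) (f' : Cochain k V V n)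
    (x : Fin (m + n + 1) → V) (t : Fin (m + n + 1)) :
    (∃ l : Fin (n + 1), ∀ v, insertArgs i f' (Function.update x t v) =
      Function.update (fun j => x (outerPos n i j)) i
        (f' (Function.update (fun l => x (innerPos i l)) l v))) ∨
    (∃ j : Fin (m + 1), ∀ v, insertArgs i f' (Function.update x t v) =
      Function.update (insertArgs i f' x) j v) := by
  rcases position_cases i t with ⟨l, rfl, hl⟩ | ⟨j, hj, rfl, hl⟩
  · left
    refine ⟨l, fun v => ?_⟩
    funext s
    rcases eq_or_ne s i with rfl | hs
    · simp only [insertArgs, Function.update_self]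
      congr 1
      exact Function.update_comp_eq_of_injective x (innerPos_injective s) l v
    · simp only [insertArgs, Function.update_of_ne hs, Function.update_of_ne (hl s hs)]
  · right
    refine ⟨j, fun v => ?_⟩
    have h1 : (fun l => Function.update x (outerPos n i j) v (innerPos i l)) =
        fun l => x (innerPos i l) := by
      funext l; rw [Function.update_of_ne (hl l)]
    have h2 : (fun s => Function.update x (outerPos n i j) v (outerPos n i s)) =
        Function.update (fun s => x (outerPos n i s)) j v :=
      Function.update_comp_eq_of_injective x (outerPos_injective n i) j v
    unfold insertArgs
    rw [h1, h2, Function.update_comm hj]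

/-- The insertion of `f'` in the `i`-th argument of `f` (numbered from `0`):
`(x_0, …, x_{m+n}) ↦ f (x_0, …, x_{i-1}, f' (x_i, …, x_{i+n}), x_{i+n+1}, …, x_{m+n})`. -/
def insertAt {m n : ℕ} (f : Cochain k V V m) (i : Fin (m + 1)) (f' : Cochain k V V n) :
    Cochain k V V (m + n) :=
  MultilinearMap.mk' (fun x => f (insertArgs i f' x))
    (by
      intro x t v w
      rcases insertArgs_update i f' x t with ⟨l, hl⟩ | ⟨j, hj⟩
      · rw [hl, hl, hl, f'.map_update_add, f.map_update_add]
      · rw [hj, hj, hj, f.map_update_add])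
    (by
      intro x t c v
      rcases insertArgs_update i f' x t with ⟨l, hl⟩ | ⟨j, hj⟩
      · rw [hl, hl, f'.map_update_smul, f.map_update_smul]
      · rw [hj, hj, f.map_update_smul])

/-- `σ` is a `(p, q)`-shuffle of the first `p + q` indices, and fixes the other ones. -/
def IsShuffle {N : ℕ} (p q : ℕ) (σ : Equiv.Perm (Fin N)) : Prop :=
  (∀ a b : Fin N, a < b → (b : ℕ) < p → σ a < σ b) ∧
  (∀ a b : Fin N, p ≤ (a : ℕ) → a < b → (b : ℕ) < p + q → σ a < σ b) ∧
  (∀ a : Fin N, p + q ≤ (a : ℕ) → σ a = a)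

instance {N : ℕ} (p q : ℕ) : DecidablePred (IsShuffle (N := N) p q) :=
  fun _ => inferInstanceAs (Decidable (_ ∧ _ ∧ _))

/-- The `i`-th partial composition, with the argument `i` numbered from `0`:
`(x_0, …, x_{m+n}) ↦ ∑_{σ ∈ Sh(i, n)} (-1)^σ`
`f (x_{σ 0}, …, x_{σ (i-1)}, f' (x_{σ i}, …, x_{σ (i+n-1)}, x_{i+n}), x_{i+n+1}, …, x_{m+n})`. -/
def circ {m n : ℕ} (f : Cochain k V V m) (i : Fin (m + 1)) (f' : Cochain k V V n) :
    Cochain k V V (m + n) :=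
  ∑ σ : Equiv.Perm (Fin (m + n + 1)) with IsShuffle i n σ,
    (Equiv.Perm.sign σ : ℤ) • (insertAt f i f').domDomCongr σ

/-- `∑_i (-1)^{i n} f ∘_i f'`, with `i` numbered from `0`. -/
def circSum {m n : ℕ} (f : Cochain k V V m) (f' : Cochain k V V n) : Cochain k V V (m + n) :=
  ∑ i : Fin (m + 1), ((-1 : ℤ) ^ ((i : ℕ) * n)) • circ f i f'

theorem circSum_apply {m n : ℕ} (f : Cochain k V V m) (f' : Cochain k V V n)
    (x : Fin (m + n + 1) → V) :
    circSum f f' x = ∑ i : Fin (m + 1), ((-1 : ℤ) ^ ((i : ℕ) * n)) •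
      ∑ σ : Equiv.Perm (Fin (m + n + 1)) with IsShuffle i n σ,
        (Equiv.Perm.sign σ : ℤ) • f (insertArgs i f' fun t => x (σ t)) := by
  simp only [circSum, circ, sum_apply, smul_apply]
  rfl

theorem insertArgs_add {m n : ℕ} (i : Fin (m + 1)) (f : Cochain k V V m) (a b : Cochain k V V n)
    (x : Fin (m + n + 1) → V) :
    f (insertArgs i (a + b) x) = f (insertArgs i a x) + f (insertArgs i b x) := by
  simp only [insertArgs, add_apply, MultilinearMap.map_update_add]

theorem insertArgs_smul {m n : ℕ} (i : Fin (m + 1)) (f : Cochain k V V m) (c : k)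
    (a : Cochain k V V n) (x : Fin (m + n + 1) → V) :
    f (insertArgs i (c • a) x) = c • f (insertArgs i a x) := by
  simp only [insertArgs, smul_apply, MultilinearMap.map_update_smul]

/-- `circSum` as a bilinear map. -/
def circSumₗ (m n : ℕ) : Cochain k V V m →ₗ[k] Cochain k V V n →ₗ[k] Cochain k V V (m + n) :=
  LinearMap.mk₂ k circSum
    (by
      intro a b f'; ext x
      simp only [circSum_apply, add_apply, smul_add, Finset.sum_add_distrib])
    (by
      intro c a f'; ext x
      simp only [circSum_apply, smul_apply, Finset.smul_sum, smul_comm c])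
    (by
      intro f a b; ext x
      simp only [circSum_apply, add_apply, insertArgs_add, smul_add,
        Finset.sum_add_distrib])
    (by
      intro c f a; ext x
      simp only [circSum_apply, smul_apply, insertArgs_smul, Finset.smul_sum,
        smul_comm c])

/-- The Balavoine bracket of `f ∈ Hom(V^{⊗ (m+1)}, V)` and `f' ∈ Hom(V^{⊗ (n+1)}, V)`, as a
bilinear map with values in the total space. -/
noncomputable def balavoineAux (m n : ℕ) :
    Cochain k V V m →ₗ[k] Cochain k V V n →ₗ[k] CochainSpace k V V :=
  (circSumₗ m n).compr₂ (DirectSum.lof k ℕ (Cochain k V V) (m + n)) +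
    (-((-1 : k) ^ (m * n))) •
      ((circSumₗ n m).compr₂ (DirectSum.lof k ℕ (Cochain k V V) (n + m))).flip

variable (k V) in
/-- The Balavoine bracket on `⨁_{n ≥ 0} Hom(V^{⊗ (n+1)}, V)`. -/
noncomputable def balavoine :
    CochainSpace k V V →ₗ[k] CochainSpace k V V →ₗ[k] CochainSpace k V V :=
  DirectSum.toModule k ℕ _ fun m =>
    (DirectSum.toModule k ℕ _ fun n => (balavoineAux m n).flip).flip

theorem balavoine_lof (m n : ℕ) (f : Cochain k V V m) (f' : Cochain k V V n) :
    balavoine k V (DirectSum.lof k ℕ (Cochain k V V) m f) (DirectSum.lof k ℕ (Cochain k V V) n f') =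
      DirectSum.lof k ℕ (Cochain k V V) (m + n) (circSum f f') -
        ((-1 : k) ^ (m * n)) • DirectSum.lof k ℕ (Cochain k V V) (n + m) (circSum f' f) := by
  simp [balavoine, balavoineAux, circSumₗ, DirectSum.toModule_lof, sub_eq_add_neg]

end Balavoine

/-! ### The derived bracket and the differential -/

section Derived

variable {k g h : Type*} [Field k] [AddCommGroup g] [Module k g] [AddCommGroup h] [Module k h]

/-- A bilinear map as a multilinear map of two variables. -/
def toCochain {V : Type*} [AddCommGroup V] [Module k V] (B : V →ₗ[k] V →ₗ[k] V) :
    Cochain k V V 1 :=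
  MultilinearMap.mk' (fun x => B (x 0) (x 1))
    (by
      intro x t v w
      rcases (show ∀ t : Fin (1 + 1), t = 0 ∨ t = 1 by decide) t with rfl | rfl
      · simp
      · simp)
    (by
      intro x t c v
      rcases (show ∀ t : Fin (1 + 1), t = 0 ∨ t = 1 by decide) t with rfl | rfl
      · simp
      · simp)

/-- `θ = μg + ρL + ρR`:
`θ ((x, u), (y, v)) = (μg x y, ρL x v + ρR u y)`, as a bilinear map on `g ⊕ h`. -/
def thetaBilin (μg : g →ₗ[k] g →ₗ[k] g) (ρL : g →ₗ[k] h →ₗ[k] h) (ρR : h →ₗ[k] g →ₗ[k] h) :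
    (g × h) →ₗ[k] (g × h) →ₗ[k] (g × h) :=
  LinearMap.mk₂ k (fun p q => (μg p.1 q.1, ρL p.1 q.2 + ρR p.2 q.1))
    (by intro a b c; ext <;> simp; abel)
    (by intro a b c; ext <;> simp)
    (by intro a b c; ext <;> simp; abel)
    (by intro a b c; ext <;> simp)

/-- `θ' = -c μh`: `θ' ((x, u), (y, v)) = (0, -c μh u v)`, as a bilinear map on `g ⊕ h`. -/
def thetaBilin' (μh : h →ₗ[k] h →ₗ[k] h) (c : k) : (g × h) →ₗ[k] (g × h) →ₗ[k] (g × h) :=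
  LinearMap.mk₂ k (fun p q => (0, -(c • μh p.2 q.2)))
    (by intro a b c; ext <;> simp; abel)
    (by intro a p q; ext <;> simp [smul_comm c a])
    (by intro a b c; ext <;> simp; abel)
    (by intro a p q; ext <;> simp [smul_comm c])

/-- `θ` as an element of `⨁_{n ≥ 0} Hom((g ⊕ h)^{⊗ (n+1)}, g ⊕ h)`. -/
noncomputable def theta (μg : g →ₗ[k] g →ₗ[k] g) (ρL : g →ₗ[k] h →ₗ[k] h)
    (ρR : h →ₗ[k] g →ₗ[k] h) : CochainSpace k (g × h) (g × h) :=
  DirectSum.lof k ℕ (Cochain k (g × h) (g × h)) 1 (toCochain (thetaBilin μg ρL ρR))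

variable (g) in
/-- `θ'` as an element of `⨁_{n ≥ 0} Hom((g ⊕ h)^{⊗ (n+1)}, g ⊕ h)`. -/
noncomputable def theta' (μh : h →ₗ[k] h →ₗ[k] h) (c : k) : CochainSpace k (g × h) (g × h) :=
  DirectSum.lof k ℕ (Cochain k (g × h) (g × h)) 1 (toCochain (thetaBilin' μh c))

variable (k g h)

/-- The inclusion of `⨁_{n ≥ 0} Hom(h^{⊗ (n+1)}, g)` in
`⨁_{n ≥ 0} Hom((g ⊕ h)^{⊗ (n+1)}, g ⊕ h)`:
`P` is sent to `((x_0, u_0), …, (x_n, u_n)) ↦ (P (u_0, …, u_n), 0)`. -/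
noncomputable def incl : CochainSpace k h g →ₗ[k] CochainSpace k (g × h) (g × h) :=
  DirectSum.lmap fun _ =>
    (LinearMap.compMultilinearMapₗ k (LinearMap.inl k g h)).comp
      (MultilinearMap.compLinearMapₗ fun _ => LinearMap.snd k g h)

/-- The projection of `⨁_{n ≥ 0} Hom((g ⊕ h)^{⊗ (n+1)}, g ⊕ h)` on
`⨁_{n ≥ 0} Hom(h^{⊗ (n+1)}, g)`: restrict the arguments to `h`, take the component in `g`. -/
noncomputable def proj : CochainSpace k (g × h) (g × h) →ₗ[k] CochainSpace k h g :=
  DirectSum.lmap fun _ =>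
    (LinearMap.compMultilinearMapₗ k (LinearMap.fst k g h)).comp
      (MultilinearMap.compLinearMapₗ fun _ => LinearMap.inr k g h)

/-- The operator that multiplies `Hom(h^{⊗ m}, g)` by `(-1)^m`, for each `m ≥ 1`. -/
noncomputable def signOp : CochainSpace k h g →ₗ[k] CochainSpace k h g :=
  DirectSum.lmap fun n => ((-1 : k) ^ (n + 1)) • LinearMap.id

/-- The grading of `⨁_{m ≥ 1} Hom(h^{⊗ m}, g)` in which `Hom(h^{⊗ m}, g)` has degree `m`; the
components of non-positive degree are zero. -/
def grading (i : ℤ) : Submodule k (CochainSpace k h g) :=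
  ⨆ (n : ℕ) (_ : (n : ℤ) + 1 = i), LinearMap.range (DirectSum.lof k ℕ (Cochain k h g) n)

variable {k g h}

/-- The derived bracket `⟦P, Q⟧ = (-1)^m [[θ, P]_B, Q]_B`, for `P ∈ Hom(h^{⊗ m}, g)`. -/
noncomputable def derivedBracket (μg : g →ₗ[k] g →ₗ[k] g) (ρL : g →ₗ[k] h →ₗ[k] h)
    (ρR : h →ₗ[k] g →ₗ[k] h) :
    CochainSpace k h g →ₗ[k] CochainSpace k h g →ₗ[k] CochainSpace k h g :=
  ((balavoine k (g × h)).compl₁₂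
    ((balavoine k (g × h) (theta μg ρL ρR)).comp ((incl k g h).comp (signOp k g h)))
    (incl k g h)).compr₂ (proj k g h)

variable (g) in
/-- The differential `d P = [θ', P]_B`. -/
noncomputable def derivedD (μh : h →ₗ[k] h →ₗ[k] h) (c : k) :
    CochainSpace k h g →ₗ[k] CochainSpace k h g :=
  (proj k g h).comp ((balavoine k (g × h) (theta' g μh c)).comp (incl k g h))

/-- A linear map `T : h → g` as an element of `⨁_{m ≥ 1} Hom(h^{⊗ m}, g)`. -/
noncomputable def ofLinear (T : h →ₗ[k] g) : CochainSpace k h g :=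
  DirectSum.lof k ℕ (Cochain k h g) 0 <| MultilinearMap.mk' (fun x => T (x 0))
    (by
      intro x t v w
      obtain rfl : t = 0 := by omega
      simp)
    (by
      intro x t c v
      obtain rfl : t = 0 := by omega
      simp)

end Derived

end LeibnizRB

/-! The Balavoine bracket is the graded commutator of the total composition `∑ (-1)^{in} f ∘_i f'`.
This composition is a graded right pre-Lie product, and the graded commutator of such a product
satisfies the graded Jacobi identity. To avoid composing shuffles, cochains are read as functions on
words. The first letter of a word goes either to the outer map or to the inserted one, which gives
the two-term recursion `comp`; symmetry of the associator (`assoc_comm`) is then an induction on the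
word. Alternating shuffle sums obey the same recursion (`shuffleSum_succ_succ`), so both
descriptions agree (`wordMap_circSum`).

The axioms on `μg`, `μh`, `ρL`, `ρR` give `[θ, θ] = [θ', θ'] = [θ', θ] = 0`, and the maps `h^{⊗ n} →
g` bracket to zero among themselves. By Jacobi alone, `[[θ, P], Q]` is then a graded Lie bracket up
to a degree shift, with `[θ', ·]` as a differential (`derived_skew`, `derived_jacobi`,
`derived_leibniz`).

Closure is a weight argument. Bracketing with the projection `ε` of `g ⊕ h` on `h` multiplies a pure
multilinear map by the number of its inputs in `h` minus the number of its outputs in `h`. Weights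
add under the bracket; `θ` has weight 0, `θ'` weight 1, and a map `h^{⊗ n} → g` weight `n`. In
characteristic 0 the weight `n` on `n` inputs characterises the maps `h^{⊗ n} → g`
(`incl_proj_of_euler`), and `[[θ, P], Q]` and `[θ', P]` both attain this maximum. The Maurer-Cartan
equation is read off by evaluation on two letters. -/

namespace LeibnizRB

set_option linter.unusedSectionVars false

/-! ### The total composition on words and its pre-Lie identity -/

section ListComp

variable {k V W : Type*} [Field k] [AddCommGroup V] [Module k V] [AddCommGroup W] [Module k W]

variable (k) in
/-- A function on words which is linear in each letter. -/
def IsMultilin (F : List V → W) : Prop :=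
  ∀ (l l' : List V) (a b : V) (c : k),
    F (l ++ (a + c • b) :: l') = F (l ++ a :: l') + c • F (l ++ b :: l')

theorem IsMultilin.cons {F : List V → W} (hF : IsMultilin k F) (x : V) :
    IsMultilin k fun l => F (x :: l) :=
  fun l l' a b c => hF (x :: l) l' a b c

theorem IsMultilin.map_add {F : List V → W} (hF : IsMultilin k F) (a b : V) (l : List V) :
    F ((a + b) :: l) = F (a :: l) + F (b :: l) := by
  simpa using hF [] l a b 1

theorem IsMultilin.map_zero {F : List V → W} (hF : IsMultilin k F) (l : List V) :
    F (0 :: l) = 0 := by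
  -- With coefficient `-1` the axiom reads `F (0 :: l) = F (0 :: l) - F (0 :: l)`.
  simpa using hF [] l 0 0 (-1)

theorem IsMultilin.map_smul {F : List V → W} (hF : IsMultilin k F) (c : k) (a : V) (l : List V) :
    F ((c • a) :: l) = c • F (a :: l) := by
  simpa [hF.map_zero] using hF [] l 0 a c

variable (k) in
/-- The total composition of functions on words, `n + 1` being the number of letters of `G`,
computed by recursion on the first letter. -/
def comp : ℕ → (List V → W) → (List V → V) → List V → W
  | _, _, _, [] => 0
  | 0, F, G, x :: l => F (G [x] :: l) + comp 0 (fun l => F (x :: l)) G l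
  | n + 1, F, G, x :: l =>
    comp n F (fun l => G (x :: l)) l + (-1 : k) ^ (n + 1) • comp (n + 1) (fun l => F (x :: l)) G l

@[simp] theorem comp_nil (n : ℕ) (F : List V → W) (G : List V → V) : comp k n F G [] = 0 := by
  cases n <;> rfl

theorem comp_zero_cons (F : List V → W) (G : List V → V) (x : V) (l : List V) :
    comp k 0 F G (x :: l) = F (G [x] :: l) + comp k 0 (fun l => F (x :: l)) G l := rfl

theorem comp_succ_cons (n : ℕ) (F : List V → W) (G : List V → V) (x : V) (l : List V) :
    comp k (n + 1) F G (x :: l) = comp k n F (fun l => G (x :: l)) l +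
      (-1 : k) ^ (n + 1) • comp k (n + 1) (fun l => F (x :: l)) G l := rfl

theorem comp_add_left (n : ℕ) (F F' : List V → W) (G : List V → V) (l : List V) :
    comp k n (fun l => F l + F' l) G l = comp k n F G l + comp k n F' G l := by
  induction l generalizing n F F' G with
  | nil => simp
  | cons x l ih =>
    cases n with
    | zero => simp only [comp_zero_cons, ih]; abel
    | succ n => simp only [comp_succ_cons, ih, smul_add]; abel

theorem comp_smul_left (n : ℕ) (c : k) (F : List V → W) (G : List V → V) (l : List V) :
    comp k n (fun l => c • F l) G l = c • comp k n F G l := by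
  induction l generalizing n F G with
  | nil => simp
  | cons x l ih =>
    cases n with
    | zero => simp only [comp_zero_cons, ih, smul_add]
    | succ n => simp only [comp_succ_cons, ih, smul_add, smul_comm c]

theorem comp_add_right (n : ℕ) {F : List V → W} (hF : IsMultilin k F) (G G' : List V → V)
    (l : List V) :
    comp k n F (fun l => G l + G' l) l = comp k n F G l + comp k n F G' l := by
  induction l generalizing n F G G' with
  | nil => simp
  | cons x l ih =>
    cases n with
    | zero => simp only [comp_zero_cons, ih 0 (hF.cons x), hF.map_add]; abel
    | succ n => simp only [comp_succ_cons, ih n hF, ih (n + 1) (hF.cons x), smul_add]; abel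

theorem comp_smul_right (n : ℕ) (c : k) {F : List V → W} (hF : IsMultilin k F) (G : List V → V)
    (l : List V) :
    comp k n F (fun l => c • G l) l = c • comp k n F G l := by
  induction l generalizing n F G with
  | nil => simp
  | cons x l ih =>
    cases n with
    | zero => simp only [comp_zero_cons, ih 0 (hF.cons x), hF.map_smul, smul_add]
    | succ n => simp only [comp_succ_cons, ih n hF, ih (n + 1) (hF.cons x), smul_add, smul_comm c]

/-- Every term of the recursion feeds exactly `n + 1` letters to `G`, so its values on other words
are irrelevant. -/
theorem comp_congr_right (n : ℕ) (F : List V → W) {G G' : List V → V}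
    (h : ∀ l, l.length = n + 1 → G l = G' l) (l : List V) :
    comp k n F G l = comp k n F G' l := by
  induction l generalizing n F G G' with
  | nil => simp
  | cons x l ih =>
    cases n with
    | zero => rw [comp_zero_cons, comp_zero_cons, h [x] rfl, ih 0 _ h]
    | succ n =>
      rw [comp_succ_cons, comp_succ_cons, ih (n + 1) _ h,
        ih n (G := fun l => G (x :: l)) (G' := fun l => G' (x :: l)) _ fun l hl => h _ (by simp [hl])]

theorem comp_eq_zero_of_length_le (n : ℕ) (F : List V → W) (G : List V → V) (l : List V)
    (h : l.length ≤ n) : comp k n F G l = 0 := by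
  induction l generalizing n F G with
  | nil => simp
  | cons x l ih =>
    cases n with
    | zero => simp at h
    | succ n =>
      simp only [List.length_cons] at h
      rw [comp_succ_cons, ih n _ _ (by omega), ih (n + 1) _ _ (by omega)]
      simp

theorem comp_zero_right (n : ℕ) {F : List V → W} (hF : IsMultilin k F) (l : List V) :
    comp k n F (fun _ => 0) l = 0 := by
  simpa using comp_smul_right n (0 : k) hF (fun _ => (0 : V)) l

variable (k) in
/-- The associator of the total composition. -/
def assoc (n p : ℕ) (F : List V → W) (G H : List V → V) (l : List V) : W :=
  comp k p (comp k n F G) H l - comp k (n + p) F (comp k p G H) l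

/-- The nested term `F (G [H [x]] :: l)` occurs in both compositions and cancels. The two new terms
are exchanged by swapping `G` and `H`. -/
theorem assoc_zero_zero_cons {F : List V → W} (G H : List V → V)
    (x : V) (l : List V) :
    assoc k 0 0 F G H (x :: l) =
      comp k 0 (fun l => F (H [x] :: l)) G l + comp k 0 (fun l => F (G [x] :: l)) H l +
        assoc k 0 0 (fun l => F (x :: l)) G H l := by
  simp only [assoc, comp_zero_cons, comp_add_left, comp_nil, add_zero]
  abel

theorem assoc_zero_succ_cons (p : ℕ) {F : List V → W} (hF : IsMultilin k F) (G H : List V → V)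
    (x : V) (l : List V) :
    assoc k 0 (p + 1) F G H (x :: l) =
      assoc k 0 p F G (fun l => H (x :: l)) l +
        (-1 : k) ^ (p + 1) • (comp k (p + 1) (fun l => F (G [x] :: l)) H l +
        assoc k 0 (p + 1) (fun l => F (x :: l)) G H l) := by
  -- `G` takes one letter: once `x` fills it, there is no room for the output of `H`. Formally, the
  -- inner composition only meets words of `p + 1` letters, one too few.
  have h : comp k p F (comp k (p + 1) (fun l => G (x :: l)) H) l = 0 := by
    rw [comp_congr_right (G' := fun _ => 0) p F, comp_zero_right p hF]
    intro l hl
    exact comp_eq_zero_of_length_le _ _ _ _ hl.le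
  simp only [assoc, comp_succ_cons, comp_zero_cons, comp_add_left, Nat.zero_add,
    comp_add_right p hF, comp_smul_right p _ hF, h]
  module

theorem assoc_succ_zero_cons (n : ℕ) {F : List V → W} (hF : IsMultilin k F) (G H : List V → V)
    (x : V) (l : List V) :
    assoc k (n + 1) 0 F G H (x :: l) =
      assoc k n 0 F (fun l => G (x :: l)) H l +
        (-1 : k) ^ (n + 1) • (comp k (n + 1) (fun l => F (H [x] :: l)) G l +
        assoc k (n + 1) 0 (fun l => F (x :: l)) G H l) := by
  simp only [assoc, comp_succ_cons, comp_zero_cons, comp_add_left, comp_smul_left, Nat.add_zero,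
    comp_add_right n hF]
  module

/-- The first letter enters `H`, `G` or `F`, and each choice leaves an associator on the shorter
word. Swapping `G` and `H` exchanges the first two terms and preserves the third. -/
theorem assoc_succ_succ_cons (n p : ℕ) {F : List V → W} (hF : IsMultilin k F)
    (G H : List V → V) (x : V) (l : List V) :
    assoc k (n + 1) (p + 1) F G H (x :: l) =
      assoc k (n + 1) p F G (fun l => H (x :: l)) l +
        (-1 : k) ^ (p + 1) • assoc k n (p + 1) F (fun l => G (x :: l)) H l +
        (-1 : k) ^ (n + p) • assoc k (n + 1) (p + 1) (fun l => F (x :: l)) G H l := by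
  have e : n + 1 + (p + 1) = (n + p + 1) + 1 := by omega
  have e1 : n + 1 + p = n + p + 1 := by omega
  have e2 : n + (p + 1) = n + p + 1 := by omega
  simp only [assoc, e, e1, e2, comp_succ_cons, comp_add_left, comp_smul_left,
    comp_add_right _ hF, comp_smul_right _ _ hF, pow_add, pow_one]
  module

/-- The total composition is a graded right pre-Lie product. -/
theorem assoc_comm (n p : ℕ) {F : List V → W} (hF : IsMultilin k F) (G H : List V → V)
    (l : List V) :
    assoc k n p F G H l = (-1 : k) ^ (n * p) • assoc k p n F H G l := by
  induction l generalizing n p F G H with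
  | nil => simp [assoc]
  | cons x l ih =>
    rcases n with _ | n <;> rcases p with _ | p
    · rw [assoc_zero_zero_cons, assoc_zero_zero_cons, ih 0 0 (hF.cons x)]
      simp only [Nat.mul_zero, pow_zero, one_smul]
      abel
    · rw [assoc_zero_succ_cons p hF, assoc_succ_zero_cons p hF, ih _ _ hF, ih _ _ (hF.cons x)]
      simp
    · rw [assoc_zero_succ_cons n hF, assoc_succ_zero_cons n hF, ih _ _ hF, ih _ _ (hF.cons x)]
      simp
    · rw [assoc_succ_succ_cons n p hF, assoc_succ_succ_cons p n hF, ih _ _ hF G,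
        ih n _ hF, ih _ _ (hF.cons x)]
      -- All signs are reduced to `(-1)^{np}`, `(-1)^n` and `(-1)^p`, the last two being of square
      -- one.
      have h1 : (-1 : k) ^ ((n + 1) * (p + 1)) = (-1) ^ (n * p) * (-1) ^ n * (-1) ^ p * (-1) := by
        ring
      have h2 : (-1 : k) ^ ((n + 1) * p) = (-1) ^ (n * p) * (-1) ^ p := by ring
      have h3 : (-1 : k) ^ (n * (p + 1)) = (-1) ^ (n * p) * (-1) ^ n := by ring
      have hp : (-1 : k) ^ p * (-1) ^ p = 1 := by simp [← mul_pow]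
      have hn : (-1 : k) ^ n * (-1) ^ n = 1 := by simp [← mul_pow]
      rw [h1, h2, h3, pow_succ, pow_succ, pow_add, pow_add]
      match_scalars <;> grind

end ListComp

/-! ### Recursion on shuffles along the place of the first argument -/

section Shuffles

open Equiv Equiv.Perm

/-- The extension of a permutation of `Fin N` to `Fin (N + 1)` fixing `0`. -/
def extPerm {N : ℕ} (τ : Perm (Fin N)) : Perm (Fin (N + 1)) := decomposeFin.symm (0, τ)

@[simp] theorem extPerm_zero {N : ℕ} (τ : Perm (Fin N)) : extPerm τ 0 = 0 := by simp [extPerm]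

@[simp] theorem extPerm_succ {N : ℕ} (τ : Perm (Fin N)) (j : Fin N) :
    extPerm τ j.succ = (τ j).succ := by simp [extPerm]

@[simp] theorem sign_extPerm {N : ℕ} (τ : Perm (Fin N)) : sign (extPerm τ) = sign τ := by
  simp [extPerm]

theorem extPerm_injective {N : ℕ} : Function.Injective (extPerm (N := N)) := by
  intro a b h
  simpa [extPerm] using h

theorem exists_eq_extPerm {N : ℕ} {σ : Perm (Fin (N + 1))} (h : σ 0 = 0) :
    ∃ τ, extPerm τ = σ := by
  refine ⟨(decomposeFin σ).2, ?_⟩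
  have h1 : (decomposeFin σ).1 = 0 := by
    rw [← h, ← decomposeFin_symm_apply_zero (decomposeFin σ).1 (decomposeFin σ).2]
    simp
  rw [extPerm, ← h1, Prod.mk.eta, symm_apply_apply]

theorem eq_one_of_strictMono {N : ℕ} {σ : Perm (Fin N)} (h : StrictMono σ) : σ = 1 := by
  have h1 : (h.orderIsoOfSurjective σ σ.surjective) = OrderIso.refl _ := Subsingleton.elim _ _
  ext a
  exact congrArg Fin.val (DFunLike.congr_fun h1 a)

theorem isShuffle_one {N : ℕ} (p q : ℕ) : IsShuffle p q (1 : Perm (Fin N)) :=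
  ⟨fun _ _ h _ => h, fun _ _ _ h _ => h, fun _ _ => rfl⟩

theorem apply_lt_of_fixed {N : ℕ} {σ : Perm (Fin N)} {r : ℕ}
    (h : ∀ a : Fin N, r ≤ (a : ℕ) → σ a = a) (a : Fin N) (ha : (a : ℕ) < r) :
    (σ a : ℕ) < r := by
  by_contra! h1
  have := σ.injective (h _ h1)
  omega

theorem strictMono_of_fixed {N : ℕ} {σ : Perm (Fin N)} {r : ℕ}
    (h1 : ∀ a b : Fin N, a < b → (b : ℕ) < r → σ a < σ b)
    (h : ∀ a : Fin N, r ≤ (a : ℕ) → σ a = a) : StrictMono σ := by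
  intro a b hab
  rcases lt_or_ge (b : ℕ) r with hb | hb
  · exact h1 a b hab hb
  · rw [h b hb]
    rcases lt_or_ge (a : ℕ) r with ha | ha
    · have := apply_lt_of_fixed h a ha
      rw [Fin.lt_def]; omega
    · rwa [h a ha]

theorem isShuffle_zero_right {N p : ℕ} {σ : Perm (Fin N)} : IsShuffle p 0 σ ↔ σ = 1 := by
  constructor
  · rintro ⟨h1, -, h3⟩
    exact eq_one_of_strictMono (strictMono_of_fixed h1 h3)
  · rintro rfl
    exact isShuffle_one _ _

theorem isShuffle_zero_left {N q : ℕ} {σ : Perm (Fin N)} : IsShuffle 0 q σ ↔ σ = 1 := by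
  constructor
  · rintro ⟨-, h2, h3⟩
    refine eq_one_of_strictMono (strictMono_of_fixed (r := q) (fun a b hab hb => ?_) fun a ha => ?_)
    · exact h2 a b (Nat.zero_le _) hab (by omega)
    · exact h3 a (by omega)
  · rintro rfl
    exact isShuffle_one _ _

/-- First case of the recursion: the value `0` heads the first block, and deleting it shortens that
block. -/
theorem isShuffle_extPerm {N p q : ℕ} {τ : Perm (Fin N)} :
    IsShuffle (p + 1) q (extPerm τ) ↔ IsShuffle p q τ := by
  constructor
  · rintro ⟨h1, h2, h3⟩
    refine ⟨fun a b hab hb => ?_, fun a b ha hab hb => ?_, fun a ha => ?_⟩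
    · simpa using h1 a.succ b.succ (by simpa using hab) (by simpa using hb)
    · simpa using h2 a.succ b.succ (by simpa using ha) (by simpa using hab)
        (by rw [Fin.val_succ]; omega)
    · simpa using h3 a.succ (by rw [Fin.val_succ]; omega)
  · rintro ⟨h1, h2, h3⟩
    refine ⟨fun a b => ?_, fun a b => ?_, fun a => ?_⟩
    · refine Fin.cases ?_ (fun b => ?_) b
      · simp
      · refine Fin.cases (by simp) (fun a => ?_) a
        intro hab hb
        simpa using h1 a b (by simpa using hab) (by simpa using hb)
    · refine Fin.cases (by simp) (fun b => ?_) b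
      refine Fin.cases (by simp) (fun a => ?_) a
      intro ha hab hb
      rw [Fin.val_succ] at ha hb
      simpa using h2 a b (by omega) (by simpa using hab) (by omega)
    · refine Fin.cases (by simp) (fun a => ?_) a
      intro ha
      rw [Fin.val_succ] at ha
      rw [extPerm_succ, h3 a (by omega)]

theorem val_succAbove {N : ℕ} (P : Fin (N + 1)) (a : Fin N) :
    (P.succAbove a : ℕ) = if (a : ℕ) < P then (a : ℕ) else a + 1 := by
  simp only [Fin.succAbove, Fin.lt_def, Fin.val_castSucc]
  split_ifs <;> simp

/-- Second case: the value `0` heads the second block, at place `p`. The cycle brings that place to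
the front and keeps the order of the others; its sign `(-1)^p` is the cost of passing the first
block. -/
theorem isShuffle_extPerm_mul_cycleRange {N p q : ℕ} {τ : Perm (Fin N)} (hp : p < N + 1) :
    IsShuffle p (q + 1) (extPerm τ * Fin.cycleRange ⟨p, hp⟩) ↔ IsShuffle p q τ := by
  set P : Fin (N + 1) := ⟨p, hp⟩ with hP
  have e0 : (extPerm τ * Fin.cycleRange P) P = 0 := by simp
  have e1 (j : Fin N) : (extPerm τ * Fin.cycleRange P) (P.succAbove j) = (τ j).succ := by
    simp [Fin.cycleRange_succAbove]
  have hv (j : Fin N) := val_succAbove P j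
  have hPv : (P : ℕ) = p := rfl
  constructor
  · rintro ⟨h1, h2, h3⟩
    refine ⟨fun a b hab hb => ?_, fun a b ha hab hb => ?_, fun a ha => ?_⟩
    · have := h1 (P.succAbove a) (P.succAbove b) (by simpa using hab) (by rw [hv]; simp [hPv, hb])
      simpa only [e1, Fin.succ_lt_succ_iff] using this
    · have := h2 (P.succAbove a) (P.succAbove b) (by rw [hv]; split_ifs <;> omega)
        (by simpa using hab) (by rw [hv]; split_ifs <;> omega)
      simpa only [e1, Fin.succ_lt_succ_iff] using this
    · have := h3 (P.succAbove a) (by rw [hv]; split_ifs <;> omega)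
      rw [e1] at this
      have h4 := congrArg Fin.val this
      rw [hv, Fin.val_succ, if_neg (by omega)] at h4
      ext; omega
  · rintro ⟨h1, h2, h3⟩
    refine ⟨fun a b hab hb => ?_, fun a b ha hab hb => ?_, fun a ha => ?_⟩
    · have hb' : b ≠ P := fun h => by rw [h] at hb; omega
      have ha' : a ≠ P := fun h => by rw [h, Fin.lt_def] at hab; omega
      obtain ⟨a, rfl⟩ := Fin.exists_succAbove_eq ha'
      obtain ⟨b, rfl⟩ := Fin.exists_succAbove_eq hb'
      rw [e1, e1, Fin.succ_lt_succ_iff]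
      refine h1 a b (by simpa using hab) ?_
      rw [hv] at hb
      split_ifs at hb <;> omega
    · have hb' : b ≠ P := fun h => by rw [h, Fin.lt_def] at hab; omega
      obtain ⟨b, rfl⟩ := Fin.exists_succAbove_eq hb'
      rcases eq_or_ne a P with rfl | ha'
      · rw [e0, e1]; simp
      obtain ⟨a, rfl⟩ := Fin.exists_succAbove_eq ha'
      rw [e1, e1, Fin.succ_lt_succ_iff]
      rw [hv] at ha hb
      refine h2 a b ?_ (by simpa using hab) ?_
      · split_ifs at ha <;> omega
      · split_ifs at hb <;> omega
    · have ha' : a ≠ P := fun h => by rw [h] at ha; omega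
      obtain ⟨a, rfl⟩ := Fin.exists_succAbove_eq ha'
      rw [hv] at ha
      have h5 : p + q ≤ a := by split_ifs at ha <;> omega
      rw [e1, h3 a h5]
      ext
      rw [hv, Fin.val_succ, if_neg (by omega)]

/-- The place of the value `0` is the start of one of the two blocks or a fixed point; all but the
start of the second block force `σ 0 = 0`. Hence the two cases above are exhaustive. -/
theorem IsShuffle.apply_eq_zero {N p q : ℕ} {σ : Perm (Fin (N + 1))} (hp : p + 1 < N + 1)
    (h : IsShuffle (p + 1) q σ) (h0 : σ 0 ≠ 0) : σ ⟨p + 1, hp⟩ = 0 := by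
  obtain ⟨h1, h2, h3⟩ := h
  obtain ⟨a, ha⟩ := σ.surjective 0
  have ha0 : a ≠ 0 := by rintro rfl; exact h0 ha
  have ha0' : 0 < (a : ℕ) := Fin.pos_iff_ne_zero.mpr ha0
  rcases lt_trichotomy (a : ℕ) (p + 1) with h | h | h
  · have := h1 0 a ha0' h
    rw [ha] at this
    exact absurd this (Fin.not_lt_zero _)
  · rw [← ha]; congr 1; ext; exact h.symm
  · rcases lt_or_ge (a : ℕ) (p + 1 + q) with h' | h'
    · have := h2 ⟨p + 1, hp⟩ a le_rfl h h'
      rw [ha] at this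
      exact absurd this (Fin.not_lt_zero _)
    · exact absurd ((h3 a h').symm.trans ha) ha0

variable {k V W : Type*} [Field k] [AddCommGroup V] [Module k V] [AddCommGroup W] [Module k W]

/-- The alternating sum over `(p, q)`-shuffles of the values of `Φ` on the permuted families. -/
def shuffleSum (N p q : ℕ) (Φ : (Fin N → V) → W) (x : Fin N → V) : W :=
  ∑ σ : Perm (Fin N) with IsShuffle p q σ, (sign σ : ℤ) • Φ fun t => x (σ t)

theorem shuffleSum_zero_right (N p : ℕ) (Φ : (Fin N → V) → W) (x : Fin N → V) :
    shuffleSum N p 0 Φ x = Φ x := by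
  simp [shuffleSum, isShuffle_zero_right, Finset.filter_eq']

theorem shuffleSum_zero_left (N q : ℕ) (Φ : (Fin N → V) → W) (x : Fin N → V) :
    shuffleSum N 0 q Φ x = Φ x := by
  simp [shuffleSum, isShuffle_zero_left, Finset.filter_eq']

/-- The recursion of alternating shuffle sums on the place of the first argument. -/
theorem shuffleSum_succ_succ (N p q : ℕ) (hp : p + 1 < N + 1) (Φ : (Fin (N + 1) → V) → W)
    (x : Fin (N + 1) → V) :
    shuffleSum (N + 1) (p + 1) (q + 1) Φ x =
      shuffleSum N p (q + 1) (fun y => Φ (Fin.cons (x 0) y)) (Fin.tail x) +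
        (-1 : ℤ) ^ (p + 1) •
          shuffleSum N (p + 1) q (fun y => Φ (Fin.insertNth ⟨p + 1, hp⟩ (x 0) y)) (Fin.tail x) := by
  have hx (τ : Perm (Fin N)) :
      (fun t => x (extPerm τ t)) = Fin.cons (x 0) fun t => Fin.tail x (τ t) := by
    funext t
    refine Fin.cases ?_ (fun t => ?_) t <;> simp [Fin.tail]
  unfold shuffleSum
  rw [← Finset.sum_filter_add_sum_filter_not _ (fun σ : Perm (Fin (N + 1)) => σ 0 = 0),
    Finset.smul_sum]
  congr 1
  · symm
    refine Finset.sum_bij (fun τ _ => extPerm τ) ?_ ?_ ?_ ?_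
    · intro τ hτ
      simpa [isShuffle_extPerm] using hτ
    · intro a _ b _ h
      exact extPerm_injective h
    · intro σ hσ
      simp only [Finset.mem_filter, Finset.mem_univ, true_and] at hσ
      obtain ⟨τ, rfl⟩ := exists_eq_extPerm hσ.2
      exact ⟨τ, by simpa [isShuffle_extPerm] using hσ.1, rfl⟩
    · intro τ _
      rw [hx, sign_extPerm]
  · symm
    refine Finset.sum_bij (fun τ _ => extPerm τ * Fin.cycleRange ⟨p + 1, hp⟩) ?_ ?_ ?_ ?_
    · intro τ hτ
      simp only [Finset.mem_filter, Finset.mem_univ, true_and] at hτ ⊢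
      refine ⟨(isShuffle_extPerm_mul_cycleRange hp).mpr hτ, ?_⟩
      rw [Perm.mul_apply, Fin.cycleRange_of_lt (by simp [Fin.lt_def])]
      intro h
      rw [← extPerm_zero τ] at h
      have := congrArg Fin.val ((extPerm τ).injective h)
      rw [Fin.val_add_one_of_lt (by simp [Fin.lt_def]; omega)] at this
      simp at this
    · intro a _ b _ h
      exact extPerm_injective (mul_right_cancel h)
    · intro σ hσ
      simp only [Finset.mem_filter, Finset.mem_univ, true_and] at hσ
      have h0 := hσ.1.apply_eq_zero hp hσ.2
      -- Undoing the cycle brings the place `p + 1` to the front, so the resulting permutation fixes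
      -- `0`.
      obtain ⟨τ, hτ⟩ := exists_eq_extPerm (σ := σ * (Fin.cycleRange ⟨p + 1, hp⟩)⁻¹) (by
        exact (congrArg σ (Fin.cycleRange_symm_zero (⟨p + 1, hp⟩ : Fin (N + 1)))).trans h0)
      have hτ' : extPerm τ * Fin.cycleRange ⟨p + 1, hp⟩ = σ := by rw [hτ, inv_mul_cancel_right]
      refine ⟨τ, ?_, hτ'⟩
      simp only [Finset.mem_filter, Finset.mem_univ, true_and]
      rw [← isShuffle_extPerm_mul_cycleRange hp, hτ']
      exact hσ.1
    · intro τ _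
      have : (fun t => x ((extPerm τ * Fin.cycleRange ⟨p + 1, hp⟩) t)) =
          Fin.insertNth ⟨p + 1, hp⟩ (x 0) fun t => Fin.tail x (τ t) := by
        rw [← Fin.cons_comp_cycleRange, ← hx]
        rfl
      rw [this, map_mul, sign_extPerm, Fin.sign_cycleRange, smul_smul]
      push_cast
      rw [mul_comm]

end Shuffles

/-! ### Comparison of partial compositions of cochains with compositions on words -/

section CochainLists

variable {k V W : Type*} [Field k] [AddCommGroup V] [Module k V] [AddCommGroup W] [Module k W]

/-- The insertion of `G`, a function of `q + 1` letters, in `F` after its first `p` letters. -/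
def insertWord (p q : ℕ) (F : List V → W) (G : List V → V) (l : List V) : W :=
  F (l.take p ++ G ((l.drop p).take (q + 1)) :: l.drop (p + q + 1))

variable (k) in
/-- The alternating sum over `(p, q)`-shuffles of the insertions of `G` in `F`, computed by
recursion on the first letter. -/
def shuffleInsert : ℕ → ℕ → (List V → W) → (List V → V) → List V → W
  | _, _, _, _, [] => 0
  | 0, 0, F, G, x :: l => F (G [x] :: l)
  | 0, q + 1, F, G, x :: l => shuffleInsert 0 q F (fun l => G (x :: l)) l
  | p + 1, 0, F, G, x :: l => shuffleInsert p 0 (fun l => F (x :: l)) G l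
  | p + 1, q + 1, F, G, x :: l =>
    shuffleInsert p (q + 1) (fun l => F (x :: l)) G l +
      (-1 : k) ^ (p + 1) • shuffleInsert (p + 1) q F (fun l => G (x :: l)) l

/-- Both sides follow the first letter. If it joins `G`, its shuffle sign `(-1)^{p+1}` turns
`(-1)^{(p+1)(q+1)}` into `(-1)^{(p+1)q}`; if it joins `F`, the factor `(-1)^{q+1}` splits off. The
bound `M` on `p` is kept in the first branch and lowered in the second, so it has to vary in the
induction. -/
theorem comp_eq_sum_shuffleInsert (q M : ℕ) (F : List V → W) (G : List V → V) (l : List V)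
    (h : l.length ≤ M + q) :
    comp k q F G l = ∑ p ∈ Finset.range M, (-1 : k) ^ (p * q) • shuffleInsert k p q F G l := by
  induction l generalizing q M F G with
  | nil => cases q <;> simp [shuffleInsert]
  | cons x l ih =>
    rw [List.length_cons] at h
    rcases M with _ | M
    · rw [comp_eq_zero_of_length_le _ _ _ _ (by simp; omega)]
      simp
    rcases q with _ | q
    · rw [comp_zero_cons, ih 0 M _ _ (by omega), Finset.sum_range_succ']
      simp [shuffleInsert, add_comm]
    · rw [comp_succ_cons, ih q (M + 1) _ _ (by omega), ih (q + 1) M _ _ (by omega),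
        Finset.sum_range_succ', Finset.sum_range_succ']
      simp only [shuffleInsert, smul_add, Finset.sum_add_distrib, Finset.smul_sum, smul_smul]
      have e1 (p : ℕ) : (-1 : k) ^ ((p + 1) * (q + 1)) * (-1) ^ (p + 1) = (-1) ^ ((p + 1) * q) := by
        rw [Nat.mul_succ, pow_add, mul_assoc, ← mul_pow]; simp
      have e2 (p : ℕ) : (-1 : k) ^ ((p + 1) * (q + 1)) = (-1) ^ (q + 1) * (-1) ^ (p * (q + 1)) := by
        rw [Nat.succ_mul, pow_add, mul_comm]
      simp only [e1]
      simp only [e2, Nat.zero_mul, pow_zero, one_smul]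
      abel

theorem insertWord_zero_left (q : ℕ) (F : List V → W) (G : List V → V) (l : List V)
    (h : q < l.length) : insertWord 0 q F G l = shuffleInsert k 0 q F G l := by
  induction l generalizing q G with
  | nil => simp at h
  | cons x l ih =>
    cases q with
    | zero => simp [insertWord, shuffleInsert]
    | succ q =>
      rw [shuffleInsert, ← ih q (fun l => G (x :: l)) (by simpa using h)]
      simp [insertWord]

theorem insertWord_succ_cons (p q : ℕ) (F : List V → W) (G : List V → V) (x : V) (l : List V) :
    insertWord (p + 1) q F G (x :: l) = insertWord p q (fun l => F (x :: l)) G l := by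
  simp [insertWord, show p + 1 + q + 1 = p + q + 1 + 1 by omega]

theorem insertWord_zero_right (p : ℕ) (F : List V → W) (G : List V → V) (l : List V)
    (h : p < l.length) : insertWord p 0 F G l = shuffleInsert k p 0 F G l := by
  induction l generalizing p F with
  | nil => simp at h
  | cons x l ih =>
    cases p with
    | zero => simp [insertWord, shuffleInsert]
    | succ p =>
      rw [shuffleInsert, ← ih p (fun l => F (x :: l)) (by simpa using h), insertWord_succ_cons]

/-- The inserted block starts at place `p`, so a letter put there becomes the first letter of `G`.
-/
theorem insertWord_insert (p q : ℕ) (F : List V → W) (G : List V → V) (x : V) (l : List V)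
    (h : p ≤ l.length) :
    insertWord p (q + 1) F G (l.take p ++ x :: l.drop p) =
      insertWord p q F (fun l => G (x :: l)) l := by
  induction l generalizing p F with
  | nil => simp at h; subst h; simp [insertWord]
  | cons y l ih =>
    cases p with
    | zero => simp [insertWord]
    | succ p =>
      simp only [List.take_succ_cons, List.cons_append, List.drop_succ_cons, insertWord_succ_cons]
      exact ih p _ (by simpa using h)

theorem ofFn_insertNth {N p : ℕ} (hp : p < N + 1) (x : V) (y : Fin N → V) :
    List.ofFn (Fin.insertNth (α := fun _ => V) ⟨p, hp⟩ x y) =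
      (List.ofFn y).take p ++ x :: (List.ofFn y).drop p := by
  induction N generalizing p with
  | zero =>
    obtain rfl : p = 0 := by omega
    simp [Fin.insertNth_zero']
  | succ N ih =>
    rcases p with _ | p
    · have : (⟨0, hp⟩ : Fin (N + 1 + 1)) = 0 := rfl
      rw [this, Fin.insertNth_zero', List.ofFn_cons]
      simp
    · have h1 : (Fin.insertNth (α := fun _ => V) ⟨p + 1, hp⟩ x y) =
          Fin.cons (y 0) (Fin.insertNth (α := fun _ => V) ⟨p, by omega⟩ x (Fin.tail y)) := by
        conv_lhs => rw [← Fin.cons_self_tail y]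
        exact Fin.insertNth_succ_cons (⟨p, by omega⟩ : Fin (N + 1)) x (y 0) (Fin.tail y)
      rw [h1, List.ofFn_cons, ih, List.ofFn_succ]
      simp [Fin.tail_def]

/-- Both sides have the same recursion and boundary cases: `hc` treats the first letter going to
`F`, and `hi` the first letter going to `G`. -/
theorem shuffleSum_insertWord (N p q : ℕ) (h : p + q < N) (F : List V → W) (G : List V → V)
    (x : Fin N → V) :
    shuffleSum N p q (fun y => insertWord p q F G (List.ofFn y)) x =
      shuffleInsert k p q F G (List.ofFn x) := by
  induction N generalizing p q F G with
  | zero => omega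
  | succ N ih =>
    rcases p with _ | p
    · rw [shuffleSum_zero_left, insertWord_zero_left (k := k) _ _ _ _ (by simp; omega)]
    rcases q with _ | q
    · rw [shuffleSum_zero_right, insertWord_zero_right (k := k) _ _ _ _ (by simp; omega)]
    rw [shuffleSum_succ_succ _ _ _ (by omega)]
    conv_rhs => rw [List.ofFn_succ, shuffleInsert]
    have hc (y : Fin N → V) : insertWord (p + 1) (q + 1) F G (List.ofFn (Fin.cons (x 0) y)) =
        insertWord p (q + 1) (fun l => F (x 0 :: l)) G (List.ofFn y) := by
      rw [List.ofFn_cons, insertWord_succ_cons]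
    have hi (y : Fin N → V) : insertWord (p + 1) (q + 1) F G
        (List.ofFn (Fin.insertNth (α := fun _ => V) ⟨p + 1, by omega⟩ (x 0) y)) =
          insertWord (p + 1) q F (fun l => G (x 0 :: l)) (List.ofFn y) := by
      rw [ofFn_insertNth, insertWord_insert _ _ _ _ _ _ (by simp; omega)]
    simp only [hc, hi]
    rw [ih p (q + 1) (by omega), ih (p + 1) q (by omega), ← Int.cast_smul_eq_zsmul k]
    push_cast
    rfl

/-- A multilinear map as a function on words, zero on the words of the wrong length. -/
def wordMap {n : ℕ} (f : Cochain k V W n) (l : List V) : W :=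
  if l.length = n + 1 then f fun i => l.getD i 0 else 0

theorem wordMap_ofFn {n : ℕ} (f : Cochain k V W n) (x : Fin (n + 1) → V) :
    wordMap f (List.ofFn x) = f x := by
  rw [wordMap, if_pos (by simp)]
  congr 1
  funext i
  simp [-List.ofFn_succ, Nat.le_of_lt_succ i.isLt]

theorem wordMap_of_length_ne {n : ℕ} (f : Cochain k V W n) {l : List V} (h : l.length ≠ n + 1) :
    wordMap f l = 0 := if_neg h

theorem exists_ofFn {n : ℕ} {l : List V} (h : l.length = n) : ∃ x : Fin n → V, l = List.ofFn x := by
  subst h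
  exact ⟨l.get, (List.ofFn_get l).symm⟩

theorem isMultilin_wordMap {n : ℕ} (f : Cochain k V W n) : IsMultilin k (wordMap f) := by
  intro l l' a b c
  by_cases h : l.length + (l'.length + 1) = n + 1
  · have e (v : V) : (fun i : Fin (n + 1) => (l ++ v :: l').getD i 0) =
        Function.update (fun i : Fin (n + 1) => (l ++ 0 :: l').getD i 0) ⟨l.length, by omega⟩ v := by
      funext i
      rcases eq_or_ne i ⟨l.length, by omega⟩ with rfl | hi
      · simp
      · rw [Function.update_of_ne hi]
        have hi' : (i : ℕ) ≠ l.length := fun e => hi (Fin.ext e)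
        rcases lt_or_gt_of_ne hi' with h1 | h1
        · rw [List.getD_append _ _ _ _ h1, List.getD_append _ _ _ _ h1]
        · rw [List.getD_append_right _ _ _ _ h1.le, List.getD_append_right _ _ _ _ h1.le]
          obtain ⟨j, hj⟩ := Nat.exists_eq_succ_of_ne_zero (n := (i : ℕ) - l.length) (by omega)
          rw [hj]
          simp
    simp only [wordMap, List.length_append, List.length_cons, h, if_true]
    rw [e, e a, e b, f.map_update_add, f.map_update_smul]
  · simp [wordMap, h]

theorem insertAt_apply {m n : ℕ} (f : Cochain k V V m) (i : Fin (m + 1)) (f' : Cochain k V V n)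
    (x : Fin (m + n + 1) → V) :
    insertAt f i f' x = insertWord i n (wordMap f) (wordMap f') (List.ofFn x) := by
  have h1 : wordMap f' (((List.ofFn x).drop i).take (n + 1)) = f' fun l => x (innerPos i l) := by
    rw [wordMap, if_pos (by simp; omega)]
    congr 1
    funext l
    have : (i : ℕ) + l < m + n + 1 := by omega
    simp [-List.ofFn_succ, List.getD_eq_getElem?_getD, innerPos, this,
      Nat.le_of_lt_succ l.isLt]
  rw [insertWord, h1, wordMap, if_pos (by simp; omega)]
  change f (insertArgs i f' x) = _
  congr 1
  funext j
  have hi : (i : ℕ) < m + n + 1 := by omega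
  -- Before the slot, arguments keep their place; at the slot stands the value of `f'`; after it,
  -- places are shifted by `n`.
  rcases lt_trichotomy j i with h | rfl | h
  · have h' : (j : ℕ) < i := h
    rw [insertArgs, Function.update_of_ne h.ne, List.getD_append _ _ _ _ (by simp; omega)]
    have h2 : (j : ℕ) < m + n + 1 := by omega
    simp [-List.ofFn_succ, List.getD_eq_getElem?_getD, h', outerPos, h, h2]
  · rw [insertArgs, Function.update_self, List.getD_append_right _ _ _ _ (by simp)]
    have h2 : min (j : ℕ) (m + n + 1) = j := by omega
    simp [h2]
  · have h' : (i : ℕ) < j := h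
    rw [insertArgs, Function.update_of_ne h.ne', List.getD_append_right _ _ _ _ (by simp; omega)]
    have h2 : min (i : ℕ) (m + n + 1) = i := by omega
    obtain ⟨r, hr⟩ := Nat.exists_eq_succ_of_ne_zero (n := (j : ℕ) - i) (by omega)
    have h3 : (i : ℕ) + n + 1 + r = j + n := by omega
    have h4 : (j : ℕ) + n < m + n + 1 := by omega
    simp [-List.ofFn_succ, h2, hr, List.getD_eq_getElem?_getD, h3, h4, outerPos, not_lt_of_gt h]

theorem circ_apply {m n : ℕ} (f : Cochain k V V m) (i : Fin (m + 1)) (f' : Cochain k V V n)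
    (x : Fin (m + n + 1) → V) :
    circ f i f' x = shuffleInsert k i n (wordMap f) (wordMap f') (List.ofFn x) := by
  rw [← shuffleSum_insertWord _ _ _ (by omega)]
  simp only [circ, sum_apply, smul_apply, shuffleSum, MultilinearMap.domDomCongr_apply,
    insertAt_apply]

/-- Each term replaces `n + 1` letters by one, so `F` only meets words with `n` letters fewer. -/
theorem comp_eq_zero_of_support (n : ℕ) (F : List V → W) (G : List V → V) (l : List V)
    (h : ∀ l' : List V, l'.length + n = l.length → F l' = 0) : comp k n F G l = 0 := by
  induction l generalizing n F G with
  | nil => simp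
  | cons x l ih =>
    simp only [List.length_cons] at h
    cases n with
    | zero =>
      rw [comp_zero_cons, h _ (by simp), ih _ _ _ fun l' hl => h _ (by simpa using hl), add_zero]
    | succ n =>
      rw [comp_succ_cons, ih n _ _ fun l' hl => h _ (by omega),
        ih (n + 1) _ _ fun l' hl => h _ (by simp only [List.length_cons]; omega)]
      rw [smul_zero, add_zero]

theorem wordMap_circSum {m n : ℕ} (f : Cochain k V V m) (f' : Cochain k V V n) :
    wordMap (circSum f f') = comp k n (wordMap f) (wordMap f') := by
  funext l
  by_cases h : l.length = m + n + 1
  · obtain ⟨x, rfl⟩ := exists_ofFn h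
    rw [wordMap_ofFn, comp_eq_sum_shuffleInsert _ (m + 1) _ _ _ (by rw [List.length_ofFn]; omega),
      ← Fin.sum_univ_eq_sum_range
        (fun p => (-1 : k) ^ (p * n) • shuffleInsert k p n (wordMap f) (wordMap f') (List.ofFn x))]
    simp only [circSum, sum_apply, smul_apply, circ_apply]
    refine Finset.sum_congr rfl fun i _ => ?_
    rw [← Int.cast_smul_eq_zsmul k]
    push_cast
    rfl
  · rw [wordMap_of_length_ne _ h, comp_eq_zero_of_support]
    intro l' hl'
    exact wordMap_of_length_ne _ (by omega)

end CochainLists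

/-! ### The Balavoine bracket as the graded commutator of a pre-Lie product -/

section BalavoineLie

variable {k V W : Type*} [Field k] [AddCommGroup V] [Module k V] [AddCommGroup W] [Module k W]

/-- The homogeneous elements of degree `n`. -/
abbrev homog (k V W : Type*) [Field k] [AddCommGroup V] [Module k V] [AddCommGroup W] [Module k W]
    (n : ℕ) : Submodule k (CochainSpace k V W) :=
  LinearMap.range (DirectSum.lof k ℕ (Cochain k V W) n)

theorem lof_mem_homog (n : ℕ) (f : Cochain k V W n) :
    DirectSum.lof k ℕ (Cochain k V W) n f ∈ homog k V W n := ⟨f, rfl⟩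

/-- The function on words defined by an element of the total space of cochains. -/
noncomputable def toWords : CochainSpace k V W →ₗ[k] List V → W :=
  DirectSum.toModule k ℕ _ fun n =>
    { toFun := fun f => wordMap f
      map_add' := fun f f' => by
        funext l
        by_cases h : l.length = n + 1 <;> simp [wordMap, h, add_apply]
      map_smul' := fun c f => by
        funext l
        by_cases h : l.length = n + 1 <;> simp [wordMap, h, smul_apply] }

@[simp] theorem toWords_lof (n : ℕ) (f : Cochain k V W n) :
    toWords (DirectSum.lof k ℕ (Cochain k V W) n f) = wordMap f := by
  simp [toWords, DirectSum.toModule_lof]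

theorem toWords_apply_ofFn (z : CochainSpace k V W) (n : ℕ) (x : Fin (n + 1) → V) :
    toWords z (List.ofFn x) = z n x := by
  classical
  induction z using DirectSum.induction_on with
  | zero => simp
  | of m f =>
    rw [← DirectSum.lof_eq_of k, toWords_lof]
    rcases eq_or_ne m n with rfl | h
    · rw [wordMap_ofFn, DirectSum.lof_apply]
    · rw [wordMap_of_length_ne _ (by simpa using h.symm), DirectSum.lof_eq_of,
        DirectSum.of_eq_of_ne _ _ _ h.symm]
      rfl
  | add a b ha hb => rw [map_add, Pi.add_apply, ha, hb, DirectSum.add_apply, add_apply]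

theorem toWords_injective : Function.Injective (toWords (k := k) (V := V) (W := W)) := by
  intro a b h
  refine DirectSum.ext_component k fun n => ?_
  ext x
  change a n x = b n x
  rw [← toWords_apply_ofFn, h, toWords_apply_ofFn]

theorem isMultilin_toWords {n : ℕ} {z : CochainSpace k V W} (hz : z ∈ homog k V W n) :
    IsMultilin k (toWords z) := by
  obtain ⟨f, rfl⟩ := hz
  rw [toWords_lof]
  exact isMultilin_wordMap f

theorem homog_ext {n : ℕ} {z z' : CochainSpace k V W} (hz : z ∈ homog k V W n)
    (hz' : z' ∈ homog k V W n) (h : ∀ l : List V, l.length = n + 1 → toWords z l = toWords z' l) :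
    z = z' := by
  apply toWords_injective
  funext l
  by_cases hl : l.length = n + 1
  · exact h l hl
  · obtain ⟨f, rfl⟩ := hz
    obtain ⟨f', rfl⟩ := hz'
    rw [toWords_lof, toWords_lof, wordMap_of_length_ne _ hl, wordMap_of_length_ne _ hl]

variable (k V) in
/-- The total composition as a bilinear product. -/
noncomputable def circProd :
    CochainSpace k V V →ₗ[k] CochainSpace k V V →ₗ[k] CochainSpace k V V :=
  DirectSum.toModule k ℕ _ fun m =>
    (DirectSum.toModule k ℕ _ fun n =>
      ((circSumₗ m n).compr₂ (DirectSum.lof k ℕ (Cochain k V V) (m + n))).flip).flip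

theorem circProd_lof (m n : ℕ) (f : Cochain k V V m) (f' : Cochain k V V n) :
    circProd k V (DirectSum.lof k ℕ (Cochain k V V) m f) (DirectSum.lof k ℕ (Cochain k V V) n f') =
      DirectSum.lof k ℕ (Cochain k V V) (m + n) (circSum f f') := by
  simp [circProd, circSumₗ, DirectSum.toModule_lof]

theorem circProd_mem {m n : ℕ} {x y : CochainSpace k V V} (hx : x ∈ homog k V V m)
    (hy : y ∈ homog k V V n) : circProd k V x y ∈ homog k V V (m + n) := by
  obtain ⟨f, rfl⟩ := hx
  obtain ⟨f', rfl⟩ := hy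
  rw [circProd_lof]
  exact lof_mem_homog _ _

theorem toWords_circProd {m n : ℕ} {x y : CochainSpace k V V} (hx : x ∈ homog k V V m)
    (hy : y ∈ homog k V V n) :
    toWords (circProd k V x y) = comp k n (toWords x) (toWords y) := by
  obtain ⟨f, rfl⟩ := hx
  obtain ⟨f', rfl⟩ := hy
  rw [circProd_lof, toWords_lof, toWords_lof, toWords_lof, wordMap_circSum]

theorem circProd_assoc_comm {m n p : ℕ} {x y z : CochainSpace k V V} (hx : x ∈ homog k V V m)
    (hy : y ∈ homog k V V n) (hz : z ∈ homog k V V p) :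
    circProd k V (circProd k V x y) z - circProd k V x (circProd k V y z) =
      (-1 : k) ^ (n * p) •
        (circProd k V (circProd k V x z) y - circProd k V x (circProd k V z y)) := by
  apply toWords_injective
  rw [map_sub, map_smul, map_sub, toWords_circProd (circProd_mem hx hy) hz,
    toWords_circProd hx (circProd_mem hy hz), toWords_circProd (circProd_mem hx hz) hy,
    toWords_circProd hx (circProd_mem hz hy), toWords_circProd hx hy, toWords_circProd hy hz,
    toWords_circProd hx hz, toWords_circProd hz hy]
  funext l
  exact assoc_comm n p (isMultilin_toWords hx) _ _ l

theorem balavoine_eq {m n : ℕ} {x y : CochainSpace k V V} (hx : x ∈ homog k V V m)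
    (hy : y ∈ homog k V V n) :
    balavoine k V x y = circProd k V x y - (-1 : k) ^ (m * n) • circProd k V y x := by
  obtain ⟨f, rfl⟩ := hx
  obtain ⟨f', rfl⟩ := hy
  rw [balavoine_lof, circProd_lof, circProd_lof]

theorem balavoine_mem {m n : ℕ} {x y : CochainSpace k V V} (hx : x ∈ homog k V V m)
    (hy : y ∈ homog k V V n) : balavoine k V x y ∈ homog k V V (m + n) := by
  rw [balavoine_eq hx hy]
  refine Submodule.sub_mem _ (circProd_mem hx hy) (Submodule.smul_mem _ _ ?_)
  rw [add_comm]
  exact circProd_mem hy hx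

theorem balavoine_skew {m n : ℕ} {x y : CochainSpace k V V} (hx : x ∈ homog k V V m)
    (hy : y ∈ homog k V V n) :
    balavoine k V x y = -((-1 : k) ^ (m * n) • balavoine k V y x) := by
  rw [balavoine_eq hx hy, balavoine_eq hy hx, mul_comm n m]
  rcases neg_one_pow_eq_or k (m * n) with h | h <;> rw [h] <;> module

/-- The graded Jacobi identity of the Balavoine bracket. -/
theorem balavoine_jacobi {m n p : ℕ} {x y z : CochainSpace k V V} (hx : x ∈ homog k V V m)
    (hy : y ∈ homog k V V n) (hz : z ∈ homog k V V p) :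
    balavoine k V x (balavoine k V y z) = balavoine k V (balavoine k V x y) z +
      (-1 : k) ^ (m * n) • balavoine k V y (balavoine k V x z) := by
  rw [balavoine_eq hx (balavoine_mem hy hz), balavoine_eq (balavoine_mem hx hy) hz,
    balavoine_eq hy (balavoine_mem hx hz), balavoine_eq hy hz, balavoine_eq hx hy,
    balavoine_eq hx hz]
  -- The pre-Lie identity is used once with each of `x`, `y`, `z` as the outer factor.
  have h1 := circProd_assoc_comm hx hy hz
  have h2 := circProd_assoc_comm hy hx hz
  have h3 := circProd_assoc_comm hz hx hy
  have e1 : (-1 : k) ^ (m * (n + p)) = (-1) ^ (m * n) * (-1) ^ (m * p) := by ring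
  have e2 : (-1 : k) ^ ((m + n) * p) = (-1) ^ (m * p) * (-1) ^ (n * p) := by ring
  have e3 : (-1 : k) ^ (n * (m + p)) = (-1) ^ (m * n) * (-1) ^ (n * p) := by ring
  rw [e1, e2, e3]
  simp only [map_sub, map_smul, LinearMap.sub_apply, LinearMap.smul_apply]
  -- Only three independent signs occur; once they are fixed, Jacobi is a signed sum of the three
  -- identities.
  rcases neg_one_pow_eq_or k (m * n) with ha | ha <;>
  rcases neg_one_pow_eq_or k (m * p) with hb | hb <;>
  rcases neg_one_pow_eq_or k (n * p) with hc | hc <;>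
  rw [ha] at h3 ⊢ <;> rw [hb] at h2 ⊢ <;> rw [hc] at h1 ⊢
  · linear_combination (norm := module) -h1 + h2 - h3
  · linear_combination (norm := module) -h1 + h2 + h3
  · linear_combination (norm := module) -h1 + h2 + h3
  · linear_combination (norm := module) -h1 + h2 - h3
  · linear_combination (norm := module) -h1 - h2 - h3
  · linear_combination (norm := module) -h1 - h2 + h3
  · linear_combination (norm := module) -h1 - h2 + h3
  · linear_combination (norm := module) -h1 - h2 - h3

theorem toWords_balavoine {m n : ℕ} {x y : CochainSpace k V V} (hx : x ∈ homog k V V m)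
    (hy : y ∈ homog k V V n) (l : List V) :
    toWords (balavoine k V x y) l = comp k n (toWords x) (toWords y) l -
      (-1 : k) ^ (m * n) • comp k m (toWords y) (toWords x) l := by
  rw [balavoine_eq hx hy, map_sub, map_smul, toWords_circProd hx hy, toWords_circProd hy hx]
  rfl

/-- All letters are consumed by `G`, and `F` receives only its output. -/
theorem comp_of_length_eq (n : ℕ) (F : List V → W) (G : List V → V) (l : List V)
    (h : l.length = n + 1) : comp k n F G l = F [G l] := by
  induction l generalizing n F G with
  | nil => simp at h
  | cons x l ih =>
    simp only [List.length_cons, Nat.add_right_cancel_iff] at h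
    cases n with
    | zero =>
      obtain rfl : l = [] := List.length_eq_zero_iff.mp h
      simp [comp_zero_cons]
    | succ n =>
      rw [comp_succ_cons, ih n _ _ h, comp_eq_zero_of_length_le _ _ _ _ h.le, smul_zero, add_zero]

theorem homog_add_induction {Pr : CochainSpace k V W → Prop} (z : CochainSpace k V W)
    (h0 : Pr 0) (hl : ∀ n f, Pr (DirectSum.lof k ℕ (Cochain k V W) n f))
    (ha : ∀ a b, Pr a → Pr b → Pr (a + b)) : Pr z := by
  classical
  induction z using DirectSum.induction_on with
  | zero => exact h0
  | of m f => exact hl m f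
  | add a b h1 h2 => exact ha a b h1 h2

end BalavoineLie

/-! ### Brackets of two bilinear maps -/

section Bilinear

variable {k V : Type*} [Field k] [AddCommGroup V] [Module k V]

theorem wordMap_toCochain (A : V →ₗ[k] V →ₗ[k] V) (x y : V) :
    wordMap (toCochain A) [x, y] = A x y := by
  rw [wordMap, if_pos (show [x, y].length = 1 + 1 from rfl)]
  rfl

/-- The hypothesis is the bracket written out on three letters; for `A = B` it is twice the left
Leibniz identity. -/
theorem balavoine_toCochain_eq_zero {A B : V →ₗ[k] V →ₗ[k] V}
    (h : ∀ x y z, A (B x y) z + A y (B x z) - A x (B y z) +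
      (B (A x y) z + B y (A x z) - B x (A y z)) = 0) :
    balavoine k V (DirectSum.lof k ℕ (Cochain k V V) 1 (toCochain A))
      (DirectSum.lof k ℕ (Cochain k V V) 1 (toCochain B)) = 0 := by
  refine homog_ext (balavoine_mem (lof_mem_homog 1 _) (lof_mem_homog 1 _))
    (Submodule.zero_mem _) fun l hl => ?_
  obtain ⟨x, y, z, rfl⟩ := List.length_eq_three.mp hl
  rw [toWords_balavoine (lof_mem_homog 1 _) (lof_mem_homog 1 _), map_zero, Pi.zero_apply, ← h x y z]
  simp only [toWords_lof, comp_succ_cons, comp_zero_cons, comp_nil, wordMap_toCochain]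
  simp only [zero_add, pow_one, mul_one, smul_zero, add_zero]
  module

end Bilinear

/-! ### Weights under the bracket with the projection on `h` -/

section Euler

variable {k g h : Type*} [Field k] [AddCommGroup g] [Module k g] [AddCommGroup h] [Module k h]

variable (k g h) in
/-- The projection of `g ⊕ h` on `h`, as an element of degree `0`. -/
noncomputable def euler : CochainSpace k (g × h) (g × h) :=
  DirectSum.lof k ℕ (Cochain k (g × h) (g × h)) 0
    (MultilinearMap.ofSubsingleton k (g × h) (g × h) (0 : Fin 1)
      (LinearMap.inr k g h ∘ₗ LinearMap.snd k g h))

theorem euler_mem : euler k g h ∈ homog k (g × h) (g × h) 0 := lof_mem_homog _ _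

theorem toWords_euler (v : g × h) : toWords (euler k g h) [v] = (0, v.2) := by
  rw [euler, toWords_lof, wordMap, if_pos (show [v].length = 0 + 1 from rfl)]
  simp

/-- On words of pure letters the first term counts the letters in `h`, and the second removes one
copy of the output in `h`: this is where the weight comes from. -/
theorem toWords_balavoine_euler {n : ℕ} {x : CochainSpace k (g × h) (g × h)}
    (hx : x ∈ homog k (g × h) (g × h) n) (l : List (g × h)) (hl : l.length = n + 1) :
    toWords (balavoine k (g × h) x (euler k g h)) l =
      comp k 0 (toWords x) (toWords (euler k g h)) l - (0, (toWords x l).2) := by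
  rw [toWords_balavoine hx euler_mem, comp_of_length_eq n _ _ _ hl, toWords_euler]
  simp

/-- Bracketing with an element of degree 0 is a derivation by Jacobi, so eigenvalues add. -/
theorem balavoine_balavoine_euler {m n : ℕ} {x y : CochainSpace k (g × h) (g × h)}
    (hx : x ∈ homog k (g × h) (g × h) m) (hy : y ∈ homog k (g × h) (g × h) n) {a b : k}
    (ha : balavoine k (g × h) x (euler k g h) = a • x)
    (hb : balavoine k (g × h) y (euler k g h) = b • y) :
    balavoine k (g × h) (balavoine k (g × h) x y) (euler k g h) =
      (a + b) • balavoine k (g × h) x y := by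
  have h1 := balavoine_jacobi hx hy euler_mem
  rw [ha, hb, map_smul, map_smul, balavoine_skew hy hx, mul_comm n m] at h1
  rcases neg_one_pow_eq_or k (m * n) with h | h <;> rw [h] at h1 <;>
    linear_combination (norm := module) -h1

theorem toWords_incl_lof (n : ℕ) (P : Cochain k h g n) (l : List (g × h)) :
    toWords (incl k g h (DirectSum.lof k ℕ (Cochain k h g) n P)) l =
      (wordMap P (l.map Prod.snd), 0) := by
  rw [incl, DirectSum.lmap_lof, toWords_lof]
  by_cases hl : l.length = n + 1
  · obtain ⟨x, rfl⟩ := exists_ofFn hl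
    rw [wordMap_ofFn, List.map_ofFn, wordMap_ofFn]
    rfl
  · rw [wordMap_of_length_ne _ hl, wordMap_of_length_ne _ (by simpa using hl)]
    rfl

theorem incl_lof_mem (n : ℕ) (P : Cochain k h g n) :
    incl k g h (DirectSum.lof k ℕ (Cochain k h g) n P) ∈ homog k (g × h) (g × h) n := by
  rw [incl, DirectSum.lmap_lof]
  exact lof_mem_homog _ _

theorem proj_lof_mem (n : ℕ) (f : Cochain k (g × h) (g × h) n) :
    proj k g h (DirectSum.lof k ℕ (Cochain k (g × h) (g × h)) n f) ∈ homog k h g n := by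
  rw [proj, DirectSum.lmap_lof]
  exact lof_mem_homog _ _

theorem toWords_proj_lof (n : ℕ) (f : Cochain k (g × h) (g × h) n) (l : List h) :
    toWords (proj k g h (DirectSum.lof k ℕ (Cochain k (g × h) (g × h)) n f)) l =
      (wordMap f (l.map fun u => (0, u))).1 := by
  rw [proj, DirectSum.lmap_lof, toWords_lof]
  by_cases hl : l.length = n + 1
  · obtain ⟨x, rfl⟩ := exists_ofFn hl
    rw [wordMap_ofFn, List.map_ofFn, wordMap_ofFn]
    rfl
  · rw [wordMap_of_length_ne _ hl, wordMap_of_length_ne _ (by simpa using hl)]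
    rfl

theorem proj_incl (z : CochainSpace k h g) : proj k g h (incl k g h z) = z := by
  induction z using homog_add_induction with
  | h0 => simp
  | hl n f =>
    rw [proj, incl, DirectSum.lmap_lof, DirectSum.lmap_lof]
    rfl
  | ha a b h1 h2 => rw [map_add, map_add, h1, h2]

theorem incl_injective : Function.Injective (incl k g h) :=
  Function.LeftInverse.injective proj_incl

theorem comp_zero_euler_of_snd {W : Type*} [AddCommGroup W] [Module k W] (F : List h → W)
    (l : List (g × h)) :
    comp k 0 (fun l => F (l.map Prod.snd)) (toWords (euler k g h)) l =
      (l.length : k) • F (l.map Prod.snd) := by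
  induction l generalizing F with
  | nil => simp
  | cons x l ih =>
    rw [comp_zero_cons, toWords_euler]
    simp only [List.map_cons]
    rw [ih fun l => F (x.2 :: l)]
    simp [add_smul, add_comm]

theorem comp_prod_zero (n : ℕ) {V W W' : Type*} [AddCommGroup V] [Module k V]
    [AddCommGroup W] [Module k W] [AddCommGroup W'] [Module k W'] (F : List V → W)
    (G : List V → V) (l : List V) :
    comp k n (fun l => (F l, (0 : W'))) G l = (comp k n F G l, 0) := by
  induction l generalizing n F G with
  | nil => simp; rfl
  | cons x l ih => cases n <;> simp [comp_zero_cons, comp_succ_cons, ih]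

theorem balavoine_incl_euler (n : ℕ) (P : Cochain k h g n) :
    balavoine k (g × h) (incl k g h (DirectSum.lof k ℕ (Cochain k h g) n P)) (euler k g h) =
      ((n : k) + 1) • incl k g h (DirectSum.lof k ℕ (Cochain k h g) n P) := by
  have hP := incl_lof_mem n P
  refine homog_ext (balavoine_mem hP euler_mem) (Submodule.smul_mem _ _ hP) fun l hl => ?_
  have hF : toWords (incl k g h (DirectSum.lof k ℕ (Cochain k h g) n P)) =
      fun l => (wordMap P (l.map Prod.snd), 0) := funext (toWords_incl_lof n P)
  rw [toWords_balavoine_euler hP l hl, map_smul, Pi.smul_apply, hF, comp_prod_zero,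
    comp_zero_euler_of_snd, hl]
  simp

/-- `F` sees only the components of its letters in `h`, and the output of `G` has none. -/
theorem comp_incl_eq_zero (n : ℕ) {W : Type*} [AddCommGroup W] [Module k W] {F : List h → W}
    (hF : IsMultilin k F) (G : List (g × h) → g × h) (hG : ∀ l, (G l).2 = 0) (l : List (g × h)) :
    comp k n (fun l => F (l.map Prod.snd)) G l = 0 := by
  induction l generalizing n F G with
  | nil => simp
  | cons x l ih =>
    have := ih (n := n) (hF.cons x.2) G hG
    cases n with
    | zero => simp [comp_zero_cons, hG, hF.map_zero, this]
    | succ n => rw [comp_succ_cons, ih n hF _ fun l => hG _]; simp [this]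

theorem balavoine_incl_incl (x y : CochainSpace k h g) :
    balavoine k (g × h) (incl k g h x) (incl k g h y) = 0 := by
  induction x using homog_add_induction with
  | h0 => simp
  | ha a b h1 h2 => rw [map_add, map_add, LinearMap.add_apply, h1, h2, add_zero]
  | hl m P =>
    induction y using homog_add_induction with
    | h0 => simp
    | ha a b h1 h2 => rw [map_add, map_add, h1, h2, add_zero]
    | hl n Q =>
      apply toWords_injective
      funext l
      rw [toWords_balavoine (incl_lof_mem m P) (incl_lof_mem n Q)]
      have hF {m : ℕ} (P : Cochain k h g m) :
          toWords (incl k g h (DirectSum.lof k ℕ (Cochain k h g) m P)) =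
            fun l => (wordMap P (l.map Prod.snd), 0) := funext (toWords_incl_lof m P)
      rw [hF, hF, comp_prod_zero, comp_prod_zero,
        comp_incl_eq_zero _ (isMultilin_wordMap P) _ fun _ => rfl,
        comp_incl_eq_zero _ (isMultilin_wordMap Q) _ fun _ => rfl]
      simp

/-- Functions which are linear in each letter are determined by their values on the words whose
letters lie in `g` or in `h`. -/
theorem IsMultilin.ext_pure {W : Type*} [AddCommGroup W] [Module k W] {F F' : List (g × h) → W}
    (hF : IsMultilin k F) (hF' : IsMultilin k F')
    (H : ∀ l, (∀ v ∈ l, v.1 = 0 ∨ v.2 = 0) → F l = F' l) (l : List (g × h)) : F l = F' l := by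
  induction l generalizing F F' with
  | nil => exact H [] (by simp)
  | cons x l ih =>
    have hx : x = (x.1, 0) + (0, x.2) := by simp
    have h1 : F ((x.1, 0) :: l) = F' ((x.1, 0) :: l) :=
      ih (hF.cons _) (hF'.cons _) fun l hl => H _ (by simpa using hl)
    have h2 : F ((0, x.2) :: l) = F' ((0, x.2) :: l) :=
      ih (hF.cons _) (hF'.cons _) fun l hl => H _ (by simpa using hl)
    rw [hx, hF.map_add, hF'.map_add, h1, h2]

/-- The witness `c` is the number of letters in `h`, a zero letter being counted among them. -/
theorem exists_comp_zero_euler (l : List (g × h)) (hl : ∀ v ∈ l, v.1 = 0 ∨ v.2 = 0) :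
    ∃ c : ℕ, (c = l.length ∧ (∀ v ∈ l, v.1 = 0) ∨ c < l.length ∧ ∃ v ∈ l, v.2 = 0) ∧
      ∀ F : List (g × h) → g × h, IsMultilin k F →
        comp k 0 F (toWords (euler k g h)) l = (c : k) • F l := by
  induction l with
  | nil => exact ⟨0, by simp⟩
  | cons x l ih =>
    obtain ⟨c, hc, h⟩ := ih fun v hv => hl v (List.mem_cons_of_mem _ hv)
    rcases hl x List.mem_cons_self with hx | hx
    · refine ⟨c + 1, ?_, fun F hF => ?_⟩
      · rcases hc with ⟨rfl, hc⟩ | ⟨hc, v, hv, hv'⟩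
        · left; simpa [hx] using hc
        · exact Or.inr ⟨by simpa using hc, v, List.mem_cons_of_mem _ hv, hv'⟩
      · have : ((0 : g), x.2) = x := by rw [← hx]
        rw [comp_zero_cons, toWords_euler, h _ (hF.cons x), this]
        push_cast
        module
    · refine ⟨c, Or.inr ⟨?_, x, List.mem_cons_self, hx⟩, fun F hF => ?_⟩
      · rw [List.length_cons]; omega
      · have : ((0 : g), x.2) = 0 := by rw [hx]; rfl
        rw [comp_zero_cons, toWords_euler, h _ (hF.cons x), this, hF.map_zero, zero_add]

theorem IsMultilin.eq_zero_of_mem {V W : Type*} [AddCommGroup V] [Module k V] [AddCommGroup W]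
    [Module k W] {F : List V → W} (hF : IsMultilin k F) {l : List V} (h : 0 ∈ l) : F l = 0 := by
  obtain ⟨s, t, rfl⟩ := List.append_of_mem h
  simpa using hF s t 0 0 (-1)

/-- The multilinear maps `h^{⊗ (n+1)} → g` are the elements of degree `n` which have the largest
possible eigenvalue under the bracket with the projection on `h`. -/
theorem incl_proj_of_euler [CharZero k] {n : ℕ} {z : CochainSpace k (g × h) (g × h)}
    (hz : z ∈ homog k (g × h) (g × h) n)
    (he : balavoine k (g × h) z (euler k g h) = ((n : k) + 1) • z) :
    incl k g h (proj k g h z) = z := by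
  have hp : ∃ P, proj k g h z = DirectSum.lof k ℕ (Cochain k h g) n P := by
    obtain ⟨f, rfl⟩ := hz
    obtain ⟨P, hP⟩ := proj_lof_mem n f
    exact ⟨P, hP.symm⟩
  obtain ⟨P, hP⟩ := hp
  have hP' (l : List h) : wordMap P l = (toWords z (l.map fun u => (0, u))).1 := by
    rw [← toWords_lof, ← hP]
    obtain ⟨f, rfl⟩ := hz
    rw [toWords_proj_lof, toWords_lof]
  have hF := isMultilin_toWords hz
  rw [hP]
  apply toWords_injective
  funext l
  refine IsMultilin.ext_pure (isMultilin_toWords (incl_lof_mem n P)) hF (fun l hl => ?_) l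
  rw [toWords_incl_lof]
  by_cases hn : l.length = n + 1
  swap
  · rw [wordMap_of_length_ne _ (by simpa using hn)]
    obtain ⟨f, rfl⟩ := hz
    rw [toWords_lof, wordMap_of_length_ne _ hn]
    rfl
  obtain ⟨c, hc, H⟩ := exists_comp_zero_euler (k := k) l hl
  have h1 := congrFun (congrArg toWords he) l
  rw [toWords_balavoine_euler hz l hn, H _ hF, map_smul, Pi.smul_apply] at h1
  have h2 := congrArg Prod.fst h1
  have h3 := congrArg Prod.snd h1
  simp only [Prod.fst_sub, Prod.snd_sub, Prod.smul_fst, Prod.smul_snd, sub_zero] at h2 h3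
  have hsnd : (toWords z l).2 = 0 := by
    -- An output in `h` has weight `c - 1`, which cannot equal `n + 1` since `c ≤ n + 1`.
    have h4 : ((n : k) + 2 - c) • (toWords z l).2 = 0 := by
      linear_combination (norm := module) -h3
    refine (smul_eq_zero.mp h4).resolve_left fun h5 => ?_
    have h6 : ((n + 2 : ℕ) : k) = (c : k) := by push_cast; linear_combination h5
    have := Nat.cast_injective h6
    rcases hc with ⟨hc, -⟩ | ⟨hc, -⟩ <;> omega
  rcases hc with ⟨-, hc⟩ | ⟨hc, v, hv, hv'⟩
  · refine Prod.ext ?_ hsnd.symm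
    rw [hP', List.map_map]
    have : l.map ((fun u : h => ((0 : g), u)) ∘ Prod.snd) = l := by
      conv_rhs => rw [← List.map_id l]
      exact List.map_congr_left fun v hv => Prod.ext (hc v hv).symm rfl
    rw [this]
  · refine Prod.ext ?_ hsnd.symm
    -- An output in `g` has weight `c`, and here a letter in `g` forces `c < n + 1`.
    have h4 : ((n : k) + 1 - c) • (toWords z l).1 = 0 := by
      linear_combination (norm := module) -h2
    have h5 : (toWords z l).1 = 0 := by
      refine (smul_eq_zero.mp h4).resolve_left fun h5 => ?_
      have h6 : ((n + 1 : ℕ) : k) = (c : k) := by push_cast; linear_combination h5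
      have := Nat.cast_injective h6
      omega
    rw [h5]
    exact (isMultilin_wordMap P).eq_zero_of_mem (hv' ▸ List.mem_map_of_mem (f := Prod.snd) hv)

end Euler

/-! ### Identities of derived brackets, from the graded Jacobi identity -/

section DerivedBracketIdentities

variable {k V : Type*} [Field k] [AddCommGroup V] [Module k V]
variable {m n p : ℕ} {t t' x y z : CochainSpace k V V}

/-- This is Jacobi applied to `[t, [x, y]] = 0`. -/
theorem derived_skew (ht : t ∈ homog k V V 1) (hx : x ∈ homog k V V m) (hy : y ∈ homog k V V n)
    (hxy : balavoine k V x y = 0) :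
    balavoine k V (balavoine k V t x) y =
      (-1 : k) ^ (m * n) • balavoine k V (balavoine k V t y) x := by
  have h1 := balavoine_jacobi ht hx hy
  rw [hxy, map_zero, balavoine_skew hx (balavoine_mem ht hy)] at h1
  have e : (-1 : k) ^ (m * (1 + n)) = (-1) ^ m * (-1) ^ (m * n) := by ring
  rw [e, one_mul] at h1
  rcases neg_one_pow_eq_or k m with h | h <;> rw [h] at h1 <;>
    linear_combination (norm := module) -h1

theorem balavoine_self_self [CharZero k] (ht : t ∈ homog k V V 1) (hx : x ∈ homog k V V m)
    (htt : balavoine k V t t = 0) : balavoine k V t (balavoine k V t x) = 0 := by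
  have h1 := balavoine_jacobi ht ht hx
  rw [htt, map_zero, LinearMap.zero_apply, mul_one, pow_one] at h1
  have h2 : (2 : k) • balavoine k V t (balavoine k V t x) = 0 := by
    linear_combination (norm := module) h1
  exact (smul_eq_zero.mp h2).resolve_left two_ne_zero

/-- Since `[t, ·]` squares to zero, `[[t, x], [t, y]]` is up to sign `[t, [[t, x], y]]`; the rest is
Jacobi for `[t, x]`, `[t, y]`, `z`. -/
theorem derived_jacobi [CharZero k] (ht : t ∈ homog k V V 1) (hx : x ∈ homog k V V m)
    (hy : y ∈ homog k V V n) (hz : z ∈ homog k V V p) (htt : balavoine k V t t = 0) :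
    balavoine k V (balavoine k V t x) (balavoine k V (balavoine k V t y) z) =
      (-1 : k) ^ (m + 1) • balavoine k V
        (balavoine k V t (balavoine k V (balavoine k V t x) y)) z +
      (-1 : k) ^ ((m + 1) * (n + 1)) • balavoine k V (balavoine k V t y)
        (balavoine k V (balavoine k V t x) z) := by
  have h1 := balavoine_jacobi (balavoine_mem ht hx) (balavoine_mem ht hy) hz
  have h2 := balavoine_jacobi ht (balavoine_mem ht hx) hy
  rw [balavoine_self_self ht hx htt, map_zero, LinearMap.zero_apply, zero_add] at h2
  rw [h1, h2, map_smul, LinearMap.smul_apply, one_mul, add_comm 1 m, add_comm 1 n]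
  rcases neg_one_pow_eq_or k (m + 1) with h | h <;> rw [h] <;> module

/-- The operators `[t', ·]` and `[t, ·]` anticommute because `[t', t] = 0`. -/
theorem derived_leibniz (ht : t ∈ homog k V V 1) (ht' : t' ∈ homog k V V 1)
    (hx : x ∈ homog k V V m) (hy : y ∈ homog k V V n) (htt' : balavoine k V t' t = 0) :
    balavoine k V t' (balavoine k V (balavoine k V t x) y) =
      -balavoine k V (balavoine k V t (balavoine k V t' x)) y +
        (-1 : k) ^ (m + 1) • balavoine k V (balavoine k V t x) (balavoine k V t' y) := by
  have h1 := balavoine_jacobi ht' (balavoine_mem ht hx) hy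
  have h2 := balavoine_jacobi ht' ht hx
  rw [htt', map_zero, LinearMap.zero_apply, zero_add, mul_one, pow_one] at h2
  rw [h1, h2, one_mul, add_comm 1 m, map_smul, LinearMap.smul_apply]
  module

end DerivedBracketIdentities

/-! ### Brackets and weights of `θ` and `θ'` -/

section Theta

variable {k g h : Type*} [Field k] [AddCommGroup g] [Module k g] [AddCommGroup h] [Module k h]
variable {μg : g →ₗ[k] g →ₗ[k] g} {μh : h →ₗ[k] h →ₗ[k] h}
  {ρL : g →ₗ[k] h →ₗ[k] h} {ρR : h →ₗ[k] g →ₗ[k] h}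

@[simp] theorem thetaBilin_apply (a b : g × h) :
    thetaBilin μg ρL ρR a b = (μg a.1 b.1, ρL a.1 b.2 + ρR a.2 b.1) := rfl

@[simp] theorem thetaBilin'_apply (c : k) (a b : g × h) :
    thetaBilin' μh c a b = (0, -(c • μh a.2 b.2)) := rfl

theorem theta_mem : theta μg ρL ρR ∈ homog k (g × h) (g × h) 1 := lof_mem_homog _ _

theorem theta'_mem (c : k) : theta' g μh c ∈ homog k (g × h) (g × h) 1 := lof_mem_homog _ _

/-- The component in `g` is the Leibniz identity of `g`; the component in `h` splits into the three
representation axioms, one for each place of the argument in `h`. -/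
theorem balavoine_theta_theta (hg : IsLeibniz μg) (hρ : IsRepresentation μg ρL ρR) :
    balavoine k (g × h) (theta μg ρL ρR) (theta μg ρL ρR) = 0 := by
  refine balavoine_toCochain_eq_zero fun x y z => Prod.ext ?_ ?_
  · simp only [thetaBilin_apply, Prod.fst_add, Prod.fst_sub, Prod.fst_zero]
    rw [hg x.1 y.1 z.1]
    abel
  · simp only [thetaBilin_apply, Prod.snd_add, Prod.snd_sub, Prod.snd_zero, map_add,
      LinearMap.add_apply]
    rw [hρ.left_left x.1 y.1 z.2, hρ.left_right x.1 z.1 y.2, hρ.right_right y.1 z.1 x.2]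
    abel

theorem balavoine_theta'_theta' (hh : IsLeibniz μh) (c : k) :
    balavoine k (g × h) (theta' g μh c) (theta' g μh c) = 0 := by
  refine balavoine_toCochain_eq_zero fun x y z => Prod.ext ?_ ?_
  · simp
  · simp only [thetaBilin'_apply, Prod.snd_add, Prod.snd_sub, Prod.snd_zero, map_neg, map_smul,
      LinearMap.neg_apply, LinearMap.smul_apply]
    rw [hh x.2 y.2 z.2]
    module

/-- The three compatibility axioms correspond to the three places of the single argument in `g`. -/
theorem balavoine_theta'_theta (hρ : IsLeibnizRepresentation μg μh ρL ρR) (c : k) :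
    balavoine k (g × h) (theta' g μh c) (theta μg ρL ρR) = 0 := by
  refine balavoine_toCochain_eq_zero fun x y z => Prod.ext ?_ ?_
  · simp
  · simp only [thetaBilin_apply, thetaBilin'_apply, Prod.snd_add, Prod.snd_sub, Prod.snd_zero,
      map_neg, map_smul, map_zero, LinearMap.neg_apply, LinearMap.smul_apply, map_add,
      LinearMap.add_apply, LinearMap.zero_apply]
    rw [hρ.br_right x.2 y.2 z.1, hρ.br_left x.2 z.2 y.1, hρ.left_br y.2 z.2 x.1]
    module

theorem toWords_balavoine_one_zero {V : Type*} [AddCommGroup V] [Module k V]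
    {y t : CochainSpace k V V} (hy : y ∈ homog k V V 1) (ht : t ∈ homog k V V 0) (a b : V) :
    toWords (balavoine k V y t) [a, b] =
      toWords y [toWords t [a], b] + toWords y [a, toWords t [b]] -
        toWords t [toWords y [a, b]] := by
  rw [toWords_balavoine hy ht, comp_of_length_eq 1 _ _ _ rfl]
  simp [comp_zero_cons]

theorem toWords_theta (a b : g × h) :
    toWords (theta μg ρL ρR) [a, b] = thetaBilin μg ρL ρR a b := by
  rw [theta, toWords_lof, wordMap_toCochain]

theorem toWords_theta' (c : k) (a b : g × h) :
    toWords (theta' g μh c) [a, b] = thetaBilin' μh c a b := by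
  rw [theta', toWords_lof, wordMap_toCochain]

/-- Each part of `θ` has as many inputs as outputs in `h`: none for `μg`, one for `ρL` and `ρR`. -/
theorem balavoine_theta_euler :
    balavoine k (g × h) (theta μg ρL ρR) (euler k g h) = (0 : k) • theta μg ρL ρR := by
  rw [zero_smul]
  refine homog_ext (balavoine_mem theta_mem euler_mem) (Submodule.zero_mem _) fun l hl => ?_
  obtain ⟨a, b, rfl⟩ := List.length_eq_two.mp hl
  rw [toWords_balavoine_one_zero theta_mem euler_mem]
  simp [toWords_theta, toWords_euler, add_comm]

theorem balavoine_theta'_euler (c : k) :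
    balavoine k (g × h) (theta' g μh c) (euler k g h) = (1 : k) • theta' g μh c := by
  rw [one_smul]
  refine homog_ext (balavoine_mem (theta'_mem c) euler_mem) (theta'_mem c) fun l hl => ?_
  obtain ⟨a, b, rfl⟩ := List.length_eq_two.mp hl
  rw [toWords_balavoine_one_zero (theta'_mem c) euler_mem]
  simp [toWords_theta', toWords_euler]

end Theta

/-! ### Closure and the identities of the derived bracket and the differential -/

section Derived

variable {k g h : Type*} [Field k] [AddCommGroup g] [Module k g] [AddCommGroup h] [Module k h]
variable {m n p : ℕ} {x y z : CochainSpace k h g}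

theorem incl_mem (hx : x ∈ homog k h g m) : incl k g h x ∈ homog k (g × h) (g × h) m := by
  obtain ⟨P, rfl⟩ := hx
  exact incl_lof_mem m P

theorem proj_mem {w : CochainSpace k (g × h) (g × h)} (hw : w ∈ homog k (g × h) (g × h) m) :
    proj k g h w ∈ homog k h g m := by
  obtain ⟨f, rfl⟩ := hw
  exact proj_lof_mem m f

theorem signOp_eq (hx : x ∈ homog k h g m) : signOp k g h x = (-1 : k) ^ (m + 1) • x := by
  obtain ⟨P, rfl⟩ := hx
  rw [signOp, DirectSum.lmap_lof, LinearMap.smul_apply, LinearMap.id_apply, map_smul]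

theorem balavoine_incl_euler' (hx : x ∈ homog k h g m) :
    balavoine k (g × h) (incl k g h x) (euler k g h) = ((m : k) + 1) • incl k g h x := by
  obtain ⟨P, rfl⟩ := hx
  exact balavoine_incl_euler m P

variable (μg : g →ₗ[k] g →ₗ[k] g) (μh : h →ₗ[k] h →ₗ[k] h)
  (ρL : g →ₗ[k] h →ₗ[k] h) (ρR : h →ₗ[k] g →ₗ[k] h) (c : k)

theorem derivedBracket_apply (hx : x ∈ homog k h g m) (y : CochainSpace k h g) :
    derivedBracket μg ρL ρR x y = (-1 : k) ^ (m + 1) • proj k g h (balavoine k (g × h)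
      (balavoine k (g × h) (theta μg ρL ρR) (incl k g h x)) (incl k g h y)) := by
  simp [derivedBracket, signOp_eq hx]

theorem derivedD_apply (x : CochainSpace k h g) :
    derivedD g μh c x = proj k g h (balavoine k (g × h) (theta' g μh c) (incl k g h x)) := rfl

theorem derivedBracket_mem (hx : x ∈ homog k h g m) (hy : y ∈ homog k h g n) :
    derivedBracket μg ρL ρR x y ∈ homog k h g (m + n + 1) := by
  rw [derivedBracket_apply μg ρL ρR hx]
  have := balavoine_mem (balavoine_mem (theta_mem (μg := μg) (ρL := ρL) (ρR := ρR)) (incl_mem hx))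
    (incl_mem hy)
  rw [show 1 + m + n = m + n + 1 by omega] at this
  exact Submodule.smul_mem _ _ (proj_mem this)

theorem derivedD_mem (hx : x ∈ homog k h g m) : derivedD g μh c x ∈ homog k h g (m + 1) := by
  rw [derivedD_apply, add_comm]
  exact proj_mem (balavoine_mem (theta'_mem c) (incl_mem hx))

/-- The derived bracket preserves the subspace of the maps `h^{⊗ n} → g`. -/
theorem incl_derivedBracket [CharZero k] (hx : x ∈ homog k h g m) (y : CochainSpace k h g) :
    incl k g h (derivedBracket μg ρL ρR x y) = (-1 : k) ^ (m + 1) • balavoine k (g × h)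
      (balavoine k (g × h) (theta μg ρL ρR) (incl k g h x)) (incl k g h y) := by
  rw [derivedBracket_apply μg ρL ρR hx, map_smul]
  congr 1
  induction y using homog_add_induction with
  | h0 => simp
  | ha a b h1 h2 => rw [map_add, map_add, map_add, map_add, h1, h2]
  | hl n Q =>
    have hx' := incl_mem hx
    have hy' := incl_lof_mem n Q
    -- The weights add up to `0 + (m + 1) + (n + 1)`, the maximum on `m + n + 2` inputs.
    refine incl_proj_of_euler (balavoine_mem (balavoine_mem theta_mem hx') hy') ?_
    rw [balavoine_balavoine_euler (balavoine_mem theta_mem hx') hy'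
      (balavoine_balavoine_euler theta_mem hx' balavoine_theta_euler (balavoine_incl_euler' hx))
      (balavoine_incl_euler n Q)]
    push_cast
    congr 1
    ring

/-- The differential preserves the subspace of the maps `h^{⊗ n} → g`. -/
theorem incl_derivedD [CharZero k] (x : CochainSpace k h g) :
    incl k g h (derivedD g μh c x) =
      balavoine k (g × h) (theta' g μh c) (incl k g h x) := by
  rw [derivedD_apply]
  induction x using homog_add_induction with
  | h0 => simp
  | ha a b h1 h2 => rw [map_add, map_add, map_add, map_add, h1, h2]
  | hl n Q =>
    have hy' := incl_lof_mem n Q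
    -- The weight is `1 + (n + 1)`, the maximum on `n + 2` inputs.
    refine incl_proj_of_euler (balavoine_mem (theta'_mem c) hy') ?_
    rw [balavoine_balavoine_euler (theta'_mem c) hy' (balavoine_theta'_euler c)
      (balavoine_incl_euler n Q)]
    push_cast
    congr 1
    ring

/-- Index `m` is the Balavoine degree, while the degree in the new grading is `m + 1`. The
prefactors `(-1)^{m+1}` and `(-1)^{n+1}` turn the sign `(-1)^{mn}` of `derived_skew` into
`-(-1)^{(m+1)(n+1)}`. -/
theorem derivedBracket_skew [CharZero k] (hx : x ∈ homog k h g m) (hy : y ∈ homog k h g n) :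
    derivedBracket μg ρL ρR x y =
      -((-1 : k) ^ ((m + 1) * (n + 1)) • derivedBracket μg ρL ρR y x) := by
  apply incl_injective
  rw [map_neg, map_smul, incl_derivedBracket μg ρL ρR hx, incl_derivedBracket μg ρL ρR hy,
    derived_skew theta_mem (incl_mem hx) (incl_mem hy) (balavoine_incl_incl x y)]
  have e : (-1 : k) ^ ((m + 1) * (n + 1)) = (-1) ^ (m * n) * (-1) ^ m * (-1) ^ n * (-1) := by ring
  rw [e, pow_succ, pow_succ]
  rcases neg_one_pow_eq_or k n with h | h <;> rw [h] <;> module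

theorem derivedBracket_jacobi [CharZero k] (hg : IsLeibniz μg) (hρ : IsRepresentation μg ρL ρR)
    (hx : x ∈ homog k h g m) (hy : y ∈ homog k h g n) (hz : z ∈ homog k h g p) :
    derivedBracket μg ρL ρR x (derivedBracket μg ρL ρR y z) =
      derivedBracket μg ρL ρR (derivedBracket μg ρL ρR x y) z +
        (-1 : k) ^ ((m + 1) * (n + 1)) •
          derivedBracket μg ρL ρR y (derivedBracket μg ρL ρR x z) := by
  apply incl_injective
  rw [map_add, map_smul, incl_derivedBracket μg ρL ρR hx, incl_derivedBracket μg ρL ρR hy,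
    incl_derivedBracket μg ρL ρR (derivedBracket_mem μg ρL ρR hx hy),
    incl_derivedBracket μg ρL ρR hy, incl_derivedBracket μg ρL ρR hx,
    incl_derivedBracket μg ρL ρR hx]
  simp only [map_smul, LinearMap.smul_apply]
  rw [derived_jacobi theta_mem (incl_mem hx) (incl_mem hy) (incl_mem hz)
    (balavoine_theta_theta hg hρ)]
  have e : (-1 : k) ^ (m + n + 1 + 1) = (-1) ^ m * (-1) ^ n := by ring
  rw [e, pow_succ _ m, pow_succ _ n]
  rcases neg_one_pow_eq_or k m with h1 | h1 <;> rcases neg_one_pow_eq_or k n with h2 | h2 <;>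
    rw [h1, h2] <;> module

theorem derivedD_derivedD [CharZero k] (hh : IsLeibniz μh) (x : CochainSpace k h g) :
    derivedD g μh c (derivedD g μh c x) = 0 := by
  apply incl_injective
  rw [incl_derivedD, incl_derivedD, map_zero]
  induction x using homog_add_induction with
  | h0 => simp
  | ha a b h1 h2 => rw [map_add, map_add, map_add, h1, h2, add_zero]
  | hl n Q =>
    exact balavoine_self_self (theta'_mem c) (incl_lof_mem n Q) (balavoine_theta'_theta' hh c)

theorem derivedD_derivedBracket [CharZero k] (hρ : IsLeibnizRepresentation μg μh ρL ρR)
    (hx : x ∈ homog k h g m) (hy : y ∈ homog k h g n) :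
    derivedD g μh c (derivedBracket μg ρL ρR x y) =
      derivedBracket μg ρL ρR (derivedD g μh c x) y +
        (-1 : k) ^ (m + 1) • derivedBracket μg ρL ρR x (derivedD g μh c y) := by
  apply incl_injective
  rw [map_add, map_smul, incl_derivedD, incl_derivedBracket μg ρL ρR hx,
    incl_derivedBracket μg ρL ρR (derivedD_mem μh c hx), incl_derivedBracket μg ρL ρR hx,
    incl_derivedD, incl_derivedD, map_smul,
    derived_leibniz theta_mem (theta'_mem c) (incl_mem hx) (incl_mem hy)
      (balavoine_theta'_theta hρ c), pow_succ _ (m + 1)]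
  module

/-! ### The grading and the differential graded Lie algebra -/

theorem mem_grading {i : ℤ} (hx : x ∈ grading k g h i) :
    x = 0 ∨ ∃ n : ℕ, (n : ℤ) + 1 = i ∧ x ∈ homog k h g n := by
  by_cases hi : ∃ n : ℕ, (n : ℤ) + 1 = i
  · obtain ⟨n, rfl⟩ := hi
    refine Or.inr ⟨n, rfl, ?_⟩
    refine (iSup₂_le (a := homog k h g n) fun n' hn' => ?_) hx
    obtain rfl : n' = n := by omega
    exact le_rfl
  · left
    have : grading k g h i ≤ ⊥ := iSup₂_le fun n hn => absurd ⟨n, hn⟩ hi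
    exact (Submodule.mem_bot k).mp (this hx)

theorem homog_le_grading {i : ℤ} (hi : (n : ℤ) + 1 = i) : homog k h g n ≤ grading k g h i :=
  le_iSup₂_of_le n hi le_rfl

theorem apply_eq_zero_of_mem_homog (hx : x ∈ homog k h g n) (hm : m ≠ n) : x m = 0 := by
  classical
  obtain ⟨P, rfl⟩ := hx
  rw [DirectSum.lof_eq_of, DirectSum.of_eq_of_ne _ _ _ hm]

theorem isInternal_grading : DirectSum.IsInternal (grading k g h) := by
  classical
  rw [DirectSum.isInternal_submodule_iff_iSupIndep_and_iSup_eq_top]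
  constructor
  · intro i
    rw [Submodule.disjoint_def]
    intro x hx hx'
    rcases mem_grading hx with h0 | ⟨n, rfl, hn⟩
    · exact h0
    -- The `n`-th component vanishes on all other degrees and is injective on degree `n + 1`.
    have h1 : (⨆ j, ⨆ _ : j ≠ (n : ℤ) + 1, grading k g h j) ≤
        LinearMap.ker (DirectSum.component k ℕ (Cochain k h g) n) := by
      refine iSup₂_le fun j hj y hy => ?_
      rcases mem_grading hy with rfl | ⟨n', rfl, hn'⟩
      · simp
      · exact apply_eq_zero_of_mem_homog hn' fun e => hj (by rw [e])
    have h2 : x n = 0 := h1 hx'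
    obtain ⟨P, rfl⟩ := hn
    rw [DirectSum.lof_apply] at h2
    rw [h2, map_zero]
  · rw [eq_top_iff]
    intro x _
    induction x using homog_add_induction with
    | h0 => exact Submodule.zero_mem _
    | ha a b h1 h2 => exact Submodule.add_mem _ (h1 trivial) (h2 trivial)
    | hl n P =>
      exact Submodule.mem_iSup_of_mem ((n : ℤ) + 1) (homog_le_grading rfl (lof_mem_homog n P))

theorem negOnePow_smul {E : Type*} [AddCommGroup E] [Module k E] {i : ℤ} {n : ℕ}
    (hi : i = n) (x : E) : i.negOnePow • x = (-1 : k) ^ n • x := by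
  subst hi
  rw [Int.negOnePow_def, zpow_natCast, Units.smul_def, ← Int.cast_smul_eq_zsmul k]
  push_cast
  rfl

theorem isDGLieAlgebra_derived [CharZero k] (hg : IsLeibniz μg) (hh : IsLeibniz μh)
    (hρ : IsLeibnizRepresentation μg μh ρL ρR) :
    IsDGLieAlgebra (grading k g h) (derivedBracket μg ρL ρR) (derivedD g μh c) where
  isInternal := isInternal_grading
  br_mem i j x hx y hy := by
    rcases mem_grading hx with rfl | ⟨m, rfl, hm⟩
    · simp
    rcases mem_grading hy with rfl | ⟨n, rfl, hn⟩
    · simp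
    exact homog_le_grading (by push_cast; ring) (derivedBracket_mem μg ρL ρR hm hn)
  br_skew i j x hx y hy := by
    rcases mem_grading hx with rfl | ⟨m, rfl, hm⟩
    · simp
    rcases mem_grading hy with rfl | ⟨n, rfl, hn⟩
    · simp
    rw [negOnePow_smul (k := k) (n := (m + 1) * (n + 1)) (by push_cast; ring)]
    exact derivedBracket_skew μg ρL ρR hm hn
  br_jacobi i j l x hx y hy z hz := by
    rcases mem_grading hx with rfl | ⟨m, rfl, hm⟩
    · simp
    rcases mem_grading hy with rfl | ⟨n, rfl, hn⟩
    · simp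
    rcases mem_grading hz with rfl | ⟨p, rfl, hp⟩
    · simp
    rw [negOnePow_smul (k := k) (n := (m + 1) * (n + 1)) (by push_cast; ring)]
    exact derivedBracket_jacobi μg ρL ρR hg hρ.toIsRepresentation hm hn hp
  d_mem i x hx := by
    rcases mem_grading hx with rfl | ⟨m, rfl, hm⟩
    · simp
    exact homog_le_grading (by push_cast; ring) (derivedD_mem μh c hm)
  d_comp_d := derivedD_derivedD μh c hh
  d_br i j x hx y hy := by
    rcases mem_grading hx with rfl | ⟨m, rfl, hm⟩
    · simp
    rcases mem_grading hy with rfl | ⟨n, rfl, hn⟩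
    · simp
    rw [negOnePow_smul (k := k) (n := m + 1) (by push_cast; ring)]
    exact derivedD_derivedBracket μg μh ρL ρR c hρ hm hn

/-! ### Maurer-Cartan elements and relative Rota-Baxter operators -/

theorem toWords_proj {w : CochainSpace k (g × h) (g × h)} (hw : w ∈ homog k (g × h) (g × h) m)
    (l : List h) : toWords (proj k g h w) l = (toWords w (l.map fun u => (0, u))).1 := by
  obtain ⟨f, rfl⟩ := hw
  rw [toWords_proj_lof, toWords_lof]

theorem ofLinear_mem (T : h →ₗ[k] g) : ofLinear T ∈ homog k h g 0 := lof_mem_homog _ _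

theorem toWords_incl_ofLinear (T : h →ₗ[k] g) (v : g × h) :
    toWords (incl k g h (ofLinear T)) [v] = (T v.2, 0) := by
  rw [ofLinear, toWords_incl_lof, wordMap, if_pos (by rfl)]
  rfl

/-- The Maurer-Cartan equation of a linear map, in terms of its values. -/
theorem toWords_maurerCartan [CharZero k] (T : h →ₗ[k] g) (u v : h) :
    toWords (derivedD g μh c (ofLinear T) +
      (2⁻¹ : k) • derivedBracket μg ρL ρR (ofLinear T) (ofLinear T)) [u, v] =
    T (ρL (T u) v + ρR u (T v) + c • μh u v) - μg (T u) (T v) := by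
  have hT := ofLinear_mem T
  have hT' := incl_mem hT
  rw [derivedBracket_apply μg ρL ρR hT, derivedD_apply, map_add, map_smul, map_smul,
    Pi.add_apply, Pi.smul_apply, Pi.smul_apply,
    toWords_proj (balavoine_mem (theta'_mem c) hT'),
    toWords_proj (balavoine_mem (balavoine_mem theta_mem hT') hT')]
  simp only [List.map_cons, List.map_nil]
  rw [toWords_balavoine_one_zero (theta'_mem c) hT',
    toWords_balavoine_one_zero (balavoine_mem theta_mem hT') hT']
  simp only [toWords_balavoine_one_zero theta_mem hT', toWords_incl_ofLinear, toWords_theta,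
    toWords_theta', thetaBilin_apply, thetaBilin'_apply]
  simp only [Prod.fst_add, Prod.fst_sub, Prod.snd_add, Prod.snd_sub, map_zero, map_add, map_neg,
    map_smul, LinearMap.zero_apply, add_zero, zero_add, sub_zero, smul_zero,
    neg_zero, sub_neg_eq_add, pow_one]
  -- In `[[θ, T], T]` every surviving term occurs twice, which the factor `2⁻¹` undoes.
  have h2 : (2 : k) ≠ 0 := two_ne_zero
  match_scalars <;> field_simp <;> ring

theorem isRelativeRotaBaxter_iff [CharZero k] (T : h →ₗ[k] g) :
    IsRelativeRotaBaxter μg μh ρL ρR c T ↔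
      IsMaurerCartan (grading k g h) (derivedBracket μg ρL ρR) (derivedD g μh c)
        (ofLinear T) := by
  have hT := ofLinear_mem T
  have h1 : derivedD g μh c (ofLinear T) +
      (2⁻¹ : k) • derivedBracket μg ρL ρR (ofLinear T) (ofLinear T) ∈ homog k h g 1 :=
    Submodule.add_mem _ (derivedD_mem μh c hT)
      (Submodule.smul_mem _ _ (derivedBracket_mem μg ρL ρR hT hT))
  constructor
  · intro H
    refine ⟨homog_le_grading (by simp) hT, homog_ext h1 (Submodule.zero_mem _) fun l hl => ?_⟩
    obtain ⟨u, v, rfl⟩ := List.length_eq_two.mp hl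
    rw [toWords_maurerCartan, ← H u v, sub_self, map_zero, Pi.zero_apply]
  · rintro ⟨-, H⟩ u v
    have := toWords_maurerCartan μg μh ρL ρR c T u v
    rw [H, map_zero, Pi.zero_apply] at this
    exact (sub_eq_zero.mp this.symm).symm

end Derived

end LeibnizRB

theorem theorem4p1 {k g h : Type*} [Field k] [CharZero k]
    [AddCommGroup g] [Module k g] [AddCommGroup h] [Module k h]
    (μg : g →ₗ[k] g →ₗ[k] g) (μh : h →ₗ[k] h →ₗ[k] h)
    (ρL : g →ₗ[k] h →ₗ[k] h) (ρR : h →ₗ[k] g →ₗ[k] h) (c : k)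
    (hg : LeibnizRB.IsLeibniz μg) (hh : LeibnizRB.IsLeibniz μh)
    (hρ : LeibnizRB.IsLeibnizRepresentation μg μh ρL ρR) :
    -- The derived bracket and the differential are well defined: for `P` of degree `m`, the
    -- elements `(-1)^m [[θ, P]_B, Q]_B` and `[θ', P]_B` lie in the subspace of maps `h^{⊗ n} → g`.
    (∀ (n : ℕ) (P : LeibnizRB.Cochain k h g n) (Q : LeibnizRB.CochainSpace k h g),
      LeibnizRB.incl k g h (LeibnizRB.derivedBracket μg ρL ρR
          (DirectSum.lof k ℕ (LeibnizRB.Cochain k h g) n P) Q) =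
        ((-1 : k) ^ (n + 1)) • LeibnizRB.balavoine k (g × h)
          (LeibnizRB.balavoine k (g × h) (LeibnizRB.theta μg ρL ρR)
            (LeibnizRB.incl k g h (DirectSum.lof k ℕ (LeibnizRB.Cochain k h g) n P)))
          (LeibnizRB.incl k g h Q)) ∧
    (∀ P : LeibnizRB.CochainSpace k h g,
      LeibnizRB.incl k g h (LeibnizRB.derivedD g μh c P) =
        LeibnizRB.balavoine k (g × h) (LeibnizRB.theta' g μh c) (LeibnizRB.incl k g h P)) ∧
    LeibnizRB.IsDGLieAlgebra (LeibnizRB.grading k g h)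
      (LeibnizRB.derivedBracket μg ρL ρR) (LeibnizRB.derivedD g μh c) ∧
    ∀ T : h →ₗ[k] g,
      LeibnizRB.IsRelativeRotaBaxter μg μh ρL ρR c T ↔
        LeibnizRB.IsMaurerCartan (LeibnizRB.grading k g h)
          (LeibnizRB.derivedBracket μg ρL ρR) (LeibnizRB.derivedD g μh c)
          (LeibnizRB.ofLinear T) :=
  ⟨fun n P Q => LeibnizRB.incl_derivedBracket μg ρL ρR (LeibnizRB.lof_mem_homog n P) Q,
    LeibnizRB.incl_derivedD μh c, LeibnizRB.isDGLieAlgebra_derived μg μh ρL ρR c hg hh hρ,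
    LeibnizRB.isRelativeRotaBaxter_iff μg μh ρL ρR c⟩
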